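/- Let $k$ be a field and let $Y$ be a smooth variety over $k$ (an integral scheme, smooth, separated and of finite type over $k$). Let $F$ be a reduced simple normal crossing divisor on $Y$ and $D$ an effective Cartier divisor on $Y$ such that $D$ and $F$ have no common component and $D_{red}+F$ is a reduced simple normal crossing divisor. Let $j:X=Y\setminus(F+D)\hookrightarrow Y$ be the inclusion of the complement. Write $\Omega^1_Y(\log F+D)\subset j_*\Omega^1_X$ for the sheaf of absolute Kähler differentials (over $\mathbb Z$) with logarithmic poles along $D_{red}+F$, $\Omega^q_Y(\log F+D)$ for its $q$-th exterior power, and $\Omega^q_Y(\log F+D)(-D')=\Omega^q_Y(\log F+D)\otimes_{\mathcal O_Y}\mathcal O_Y(-D')$ for $D'=D$ or $D'=D_{red}$; with the exterior derivative these form complexes $\Omega^\bullet_Y(\log F+D)(-D')$ of sheaves of abelian groups for the Zariski topology of $Y$. Let $D_1,\dots,D_n$ be the irreducible components of $D$ and let $e_i$ be the multiplicity of $D_i$ in $D$. If $p=\operatorname{char}(k)>0$, assume that $e_i<p$ for all $i$. Then the inclusion $$\Omega^\bullet_Y(\log F+D)(-D)\longrightarrow\Omega^\bullet_Y(\log F+D)(-D_{red})$$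 is a quasi-isomorphism. -/

import Mathlib

universe u

namespace LogDeRham
noncomputable section

open CategoryTheory TopologicalSpace AlgebraicGeometry

section ExteriorDerivative

variable (A : Type u) [CommRing A]

/-- The exterior algebra `⨁ Ω^q_A` of absolute Kähler differential forms. -/
abbrev Forms : Type u := ExteriorAlgebra A (Ω[A⁄ℤ])

variable {A}

/-- The absolute differential `da`, as a form of degree one. -/
def dForm (a : A) : Forms A := ExteriorAlgebra.ι A (KaehlerDifferential.D ℤ A a)

lemma ι_mul_eq_involute_mul (m : Ω[A⁄ℤ]) (w : Forms A) :
    ExteriorAlgebra.ι A m * w = CliffordAlgebra.involute w * ExteriorAlgebra.ι A m := by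
  induction w using ExteriorAlgebra.induction with
  | algebraMap r => simp [Algebra.commutes]
  | ι x =>
    have h := ExteriorAlgebra.ι_add_mul_swap (R := A) m x
    have h2 : CliffordAlgebra.involute (ExteriorAlgebra.ι A x) = - ExteriorAlgebra.ι A x :=
      CliffordAlgebra.involute_ι x
    rw [h2, neg_mul]
    exact eq_neg_of_add_eq_zero_left h
  | mul a b ha hb => rw [map_mul, ← mul_assoc, ha, mul_assoc, hb, mul_assoc]
  | add a b ha hb => rw [mul_add, ha, hb, map_add, add_mul]

lemma involute_ι' (x : Ω[A⁄ℤ]) :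
    CliffordAlgebra.involute (ExteriorAlgebra.ι A x) = - ExteriorAlgebra.ι A x :=
  CliffordAlgebra.involute_ι x

/-- The ring homomorphism `a ↦ [a, da; 0, a]`. -/
def twistHom : A →+* Matrix (Fin 2) (Fin 2) (Forms A) where
  toFun a := !![algebraMap A (Forms A) a, dForm a; 0, algebraMap A (Forms A) a]
  map_one' := by
    ext i j; fin_cases i <;> fin_cases j <;> simp [dForm]
  map_mul' a b := by
    ext i j; fin_cases i <;> fin_cases j <;>
      simp [dForm, Matrix.mul_apply, Algebra.smul_def]
    exact congrArg _ (Algebra.commutes _ _)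
  map_zero' := by
    ext i j; fin_cases i <;> fin_cases j <;> simp [dForm]
  map_add' a b := by
    ext i j; fin_cases i <;> fin_cases j <;> simp [dForm]

variable (A) in
/-- The ring of matrices commuting with all `[a, da; 0, a]`, which is an `A`-algebra through
`a ↦ [a, da; 0, a]`. It contains the matrices `[±w, dw; 0, w]`. -/
def Twist : Subring (Matrix (Fin 2) (Fin 2) (Forms A)) :=
  Subring.centralizer (Set.range (twistHom (A := A)))

instance : Algebra A (Twist A) :=
  RingHom.toAlgebra'
    (RingHom.codRestrict twistHom (Twist A) (fun a => by
      rw [Twist, Subring.mem_centralizer_iff]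
      rintro _ ⟨b, rfl⟩
      rw [← map_mul, ← map_mul, mul_comm]))
    (fun a x => by
      apply Subtype.ext
      have := (Subring.mem_centralizer_iff.1 x.2) (twistHom a) ⟨a, rfl⟩
      exact this)

lemma twist_smul_val (a : A) (x : Twist A) : (a • x).1 = twistHom a * x.1 := rfl

lemma dForm_mul_swap (a b : A) : dForm a * dForm b = - (dForm b * dForm a) :=
  eq_neg_of_add_eq_zero_left (ExteriorAlgebra.ι_add_mul_swap (R := A)
    (KaehlerDifferential.D ℤ A a) (KaehlerDifferential.D ℤ A b))

lemma dForm_zero : dForm (0 : A) = 0 := by simp [dForm]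

lemma dForm_add (a b : A) : dForm (a + b) = dForm a + dForm b := by simp [dForm]

lemma dForm_mul (a b : A) : dForm (a * b) =
    algebraMap A (Forms A) a * dForm b + algebraMap A (Forms A) b * dForm a := by
  simp [dForm, Algebra.smul_def]

/-- The matrix `[-da, 0; 0, da]`. -/
def twistD (a : A) : Twist A :=
  ⟨!![-dForm a, 0; 0, dForm a], by
    rw [Twist, Subring.mem_centralizer_iff]
    rintro _ ⟨b, rfl⟩
    have h := dForm_mul_swap a b
    have hc := Algebra.commutes b (dForm a)
    ext i j; fin_cases i <;> fin_cases j <;>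
      simp [twistHom, Matrix.mul_apply, h, hc]⟩

/-- The derivation `a ↦ [-da, 0; 0, da]`. -/
def twistDer : Derivation ℤ A (Twist A) :=
  Derivation.mk'
    (AddMonoidHom.toIntLinearMap
      { toFun := twistD
        map_zero' := by
          apply Subtype.ext
          ext i j; fin_cases i <;> fin_cases j <;> simp [twistD, dForm_zero]
        map_add' := fun a b => by
          apply Subtype.ext
          ext i j; fin_cases i <;> fin_cases j <;> simp [twistD, dForm_add, add_comm] })
    (fun a b => by
      have h := dForm_mul_swap a b
      apply Subtype.ext
      change (twistD (a * b)).1 = (a • twistD b + b • twistD a).1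
      rw [Subring.coe_add, twist_smul_val, twist_smul_val]
      ext i j; fin_cases i <;> fin_cases j <;>
        simp [twistHom, twistD, dForm_mul, h, add_comm]
      · rw [Algebra.smul_def, Algebra.smul_def]
      · rw [Algebra.smul_def, Algebra.smul_def])

/-- The `A`-linear map `∑ b da ↦ [-∑ b da, ∑ db ∧ da; 0, ∑ b da]`. -/
def twistLin : Ω[A⁄ℤ] →ₗ[A] Twist A := twistDer.liftKaehlerDifferential

lemma twistLin_D (a : A) : twistLin (KaehlerDifferential.D ℤ A a) = twistD a :=
  twistDer.liftKaehlerDifferential_comp_D a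

lemma twistLin_spec (m : Ω[A⁄ℤ]) :
    (twistLin m).1 0 0 = - ExteriorAlgebra.ι A m ∧ (twistLin m).1 1 0 = 0 ∧
      (twistLin m).1 1 1 = ExteriorAlgebra.ι A m ∧
      ∀ x : Ω[A⁄ℤ], (twistLin m).1 0 1 * ExteriorAlgebra.ι A x =
        ExteriorAlgebra.ι A x * (twistLin m).1 0 1 := by
  have hm : m ∈ Submodule.span A (Set.range (KaehlerDifferential.D ℤ A)) := by
    rw [KaehlerDifferential.span_range_derivation]; trivial
  induction hm using Submodule.span_induction with
  | mem _ h => obtain ⟨a, rfl⟩ := h; simp [twistLin_D, twistD, dForm]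
  | zero => simp
  | add x y _ _ hx hy =>
    obtain ⟨h1, h2, h3, h4⟩ := hx
    obtain ⟨k1, k2, k3, k4⟩ := hy
    refine ⟨by simp [h1, k1, add_comm], by simp [h2, k2], by simp [h3, k3], fun z => ?_⟩
    simp [add_mul, mul_add, h4, k4]
  | smul a x _ hx =>
    obtain ⟨h1, h2, h3, h4⟩ := hx
    rw [map_smul, twist_smul_val]
    refine ⟨by simp [twistHom, Matrix.mul_apply, h1, h2, Algebra.smul_def],
      by simp [twistHom, Matrix.mul_apply, h2],
      by simp [twistHom, Matrix.mul_apply, h3, Algebra.smul_def], fun z => ?_⟩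
    have e : (twistHom a * (twistLin x).1) 0 1 =
        algebraMap A (Forms A) a * (twistLin x).1 0 1 + dForm a * ExteriorAlgebra.ι A x := by
      simp [twistHom, Matrix.mul_apply, h3]
    have i1 := ι_mul_eq_involute_mul z (dForm a * ExteriorAlgebra.ι A x)
    rw [map_mul, dForm, involute_ι', involute_ι', neg_mul_neg] at i1
    rw [e, add_mul, mul_add, mul_assoc, h4, dForm, i1, ← mul_assoc, ← mul_assoc,
      Algebra.commutes]

lemma twistLin_sq (m : Ω[A⁄ℤ]) : twistLin m * twistLin m = 0 := by
  obtain ⟨h1, h2, h3, h4⟩ := twistLin_spec m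
  apply Subtype.ext
  change (twistLin m).1 * (twistLin m).1 = 0
  ext i j; fin_cases i <;> fin_cases j <;>
    simp [Matrix.mul_apply, h1, h2, h3, h4]

/-- The algebra homomorphism `w ↦ [±w, dw; 0, w]`. -/
def twistLift : Forms A →ₐ[A] Twist A := ExteriorAlgebra.lift A ⟨twistLin, twistLin_sq⟩

lemma twistLift_ι (m : Ω[A⁄ℤ]) : twistLift (ExteriorAlgebra.ι A m) = twistLin m :=
  ExteriorAlgebra.lift_ι_apply A _ _ m

lemma twistLift_algebraMap (a : A) :
    (twistLift (algebraMap A (Forms A) a)).1 = twistHom a := by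
  rw [AlgHom.commutes]; rfl

lemma twistLift_spec (w : Forms A) :
    (twistLift w).1 0 0 = CliffordAlgebra.involute w ∧ (twistLift w).1 1 0 = 0 ∧
      (twistLift w).1 1 1 = w := by
  induction w using ExteriorAlgebra.induction with
  | algebraMap r => rw [twistLift_algebraMap]; simp [twistHom]
  | ι x =>
    obtain ⟨h1, h2, h3, -⟩ := twistLin_spec x
    rw [twistLift_ι, involute_ι']
    exact ⟨h1, h2, h3⟩
  | mul a b ha hb =>
    obtain ⟨h1, h2, h3⟩ := ha
    obtain ⟨k1, k2, k3⟩ := hb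
    simp [map_mul, Matrix.mul_apply, h1, h2, h3, k1, k2, k3]
  | add a b ha hb =>
    obtain ⟨h1, h2, h3⟩ := ha
    obtain ⟨k1, k2, k3⟩ := hb
    simp [h1, h2, h3, k1, k2, k3]

/-- The exterior derivative on absolute Kähler forms. It is the unique additive map with
`d(a) = da`, `d(da) = 0` and the graded Leibniz rule; see the lemmas below. -/
def extD : Forms A →+ Forms A where
  toFun w := (twistLift w).1 0 1
  map_zero' := by simp
  map_add' v w := by simp

lemma extD_algebraMap (a : A) : extD (algebraMap A (Forms A) a) = dForm a := by
  change (twistLift _).1 0 1 = _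
  rw [twistLift_algebraMap]; simp [twistHom]

lemma extD_dForm (a : A) : extD (dForm a) = 0 := by
  change (twistLift _).1 0 1 = _
  rw [dForm, twistLift_ι, twistLin_D]; simp [twistD]

lemma extD_mul (v w : Forms A) :
    extD (v * w) = extD v * w + CliffordAlgebra.involute v * extD w := by
  change (twistLift _).1 0 1 = (twistLift _).1 0 1 * _ + _ * (twistLift _).1 0 1
  simp [map_mul, Matrix.mul_apply, (twistLift_spec v).1, (twistLift_spec w).2.2, add_comm]

lemma involute_dForm (a : A) : CliffordAlgebra.involute (dForm a) = - dForm a :=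
  involute_ι' _

/-- Induction principle: forms are generated by functions and exact one-forms. -/
lemma forms_induction {C : Forms A → Prop} (h0 : ∀ a : A, C (algebraMap A (Forms A) a))
    (h1 : ∀ a : A, C (dForm a)) (hm : ∀ v w, C v → C w → C (v * w))
    (ha : ∀ v w, C v → C w → C (v + w)) (w : Forms A) : C w := by
  induction w using ExteriorAlgebra.induction with
  | algebraMap r => exact h0 r
  | ι x =>
    have hx : x ∈ Submodule.span A (Set.range (KaehlerDifferential.D ℤ A)) := by
      rw [KaehlerDifferential.span_range_derivation]; trivial
    induction hx using Submodule.span_induction with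
    | mem _ h => obtain ⟨a, rfl⟩ := h; exact h1 a
    | zero => simpa using h0 0
    | add x y _ _ hx hy => rw [map_add]; exact ha _ _ hx hy
    | smul a x _ hx => rw [map_smul, Algebra.smul_def]; exact hm _ _ (h0 a) hx
  | mul a b iha ihb => exact hm _ _ iha ihb
  | add a b iha ihb => exact ha _ _ iha ihb

lemma extD_involute (w : Forms A) :
    extD (CliffordAlgebra.involute w) = - CliffordAlgebra.involute (extD w) := by
  induction w using forms_induction with
  | h0 a => simp [extD_algebraMap, involute_dForm]
  | h1 a => simp [involute_dForm, extD_dForm]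
  | hm v w hv hw => simp [extD_mul, hv, hw]; abel
  | ha v w hv hw => simp [hv, hw]; abel

lemma extD_extD (w : Forms A) : extD (extD w) = 0 := by
  induction w using forms_induction with
  | h0 a => rw [extD_algebraMap, extD_dForm]
  | h1 a => rw [extD_dForm, map_zero]
  | hm v w hv hw => simp [extD_mul, hv, hw, extD_involute]
  | ha v w hv hw => simp [hv, hw]

end ExteriorDerivative
section LogForms

variable {R : Type u} [CommRing R] (K : Type u) [Field K] [Algebra R K]

/-- The elements of `R` that become invertible away from the closed subset defined by the ideal
`E`. For a local ring of a scheme this is the stalk of the sheaf of monoids `𝒪 ∩ j_* 𝒪ˣ`, with `j`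
the inclusion of the complement of the closed subset: the standard log structure. -/
def logUnits (E : Ideal R) : Set R := {u | E ≤ (Ideal.span {u}).radical}

/-- One-forms with logarithmic poles along `E`, inside the one-forms of the field `K`: the
`R`-module generated by all `da`, for `a` in `R`, and all `du / u`, for `u` in `logUnits E`. -/
def logOneForms (E : Ideal R) : Submodule R (Ω[K⁄ℤ]) :=
  Submodule.span R
    (Set.range (fun a : R => KaehlerDifferential.D ℤ K (algebraMap R K a)) ∪
      (fun u : R => (algebraMap R K u)⁻¹ • KaehlerDifferential.D ℤ K (algebraMap R K u)) ''
        logUnits E)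

/-- `q`-forms with logarithmic poles along `E`: the `R`-module generated by all the `q`-fold wedge
products of logarithmic one-forms. -/
def logForms (E : Ideal R) (q : ℕ) : Submodule R (Forms K) :=
  ((logOneForms K E).map ((ExteriorAlgebra.ι K).restrictScalars R)) ^ q

/-- `Ω^q(log E)(-D)`, for an ideal `D`. -/
def twistedLogForms (E D : Ideal R) (q : ℕ) : Submodule R (Forms K) := D • logForms K E q

variable {K}

lemma twistedLogForms_mono (E : Ideal R) {D D' : Ideal R} (h : D ≤ D') (q : ℕ) :
    twistedLogForms K E D q ≤ twistedLogForms K E D' q :=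
  Submodule.smul_mono_left h

lemma logForms_succ (E : Ideal R) (q : ℕ) :
    logForms K E (q + 1) = logForms K E 1 * logForms K E q := by
  rw [logForms, logForms, logForms, pow_succ', pow_one]

lemma logForms_one (E : Ideal R) : logForms K E 1 =
    (logOneForms K E).map ((ExteriorAlgebra.ι K).restrictScalars R) := by
  rw [logForms, pow_one]

lemma dForm_mem (E : Ideal R) (a : R) : dForm (algebraMap R K a) ∈ logForms K E 1 := by
  rw [logForms_one]
  exact ⟨_, Submodule.subset_span (Or.inl ⟨a, rfl⟩), rfl⟩

lemma inv_mul_dForm_mem {E : Ideal R} {u : R} (hu : u ∈ logUnits E) :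
    algebraMap K (Forms K) (algebraMap R K u)⁻¹ * dForm (algebraMap R K u) ∈
      logForms K E 1 := by
  rw [logForms_one]
  refine ⟨_, Submodule.subset_span (Or.inr ⟨u, hu, rfl⟩), ?_⟩
  simp [dForm, Algebra.smul_def]

lemma dForm_mul_self (a : K) : dForm a * dForm a = 0 :=
  ExteriorAlgebra.ι_sq_zero _

lemma extD_dlog (a : K) : extD (algebraMap K (Forms K) a⁻¹ * dForm a) = 0 := by
  have h : dForm a⁻¹ = algebraMap K (Forms K) (-a⁻¹ ^ 2) * dForm a := by
    have := (KaehlerDifferential.D ℤ K).leibniz_inv a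
    rw [dForm, this, map_smul, Algebra.smul_def]
    rfl
  rw [extD_mul, extD_algebraMap, extD_dForm, h, mul_assoc, dForm_mul_self]
  simp

lemma extD_smul (a : R) (w : Forms K) :
    extD (a • w) = dForm (algebraMap R K a) * w + a • extD w := by
  have h : ∀ v : Forms K, a • v = algebraMap K (Forms K) (algebraMap R K a) * v := fun v => by
    rw [← Algebra.smul_def, algebraMap_smul]
  rw [h, extD_mul, extD_algebraMap, h]
  simp

lemma extD_mem_logForms (E : Ideal R) (q : ℕ) :
    ∀ w ∈ logForms K E q, extD w ∈ logForms K E (q + 1) := by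
  have h1 : ∀ w ∈ logForms K E 1, extD w ∈ logForms K E 2 ∧
      CliffordAlgebra.involute w = -w := by
    rw [logForms_one]
    rintro _ ⟨x, hx, rfl⟩
    refine ⟨?_, involute_ι' x⟩
    change x ∈ logOneForms K E at hx
    change extD (ExteriorAlgebra.ι K x) ∈ _
    induction hx using Submodule.span_induction with
    | mem x h =>
      obtain ⟨a, rfl⟩ | ⟨u, -, rfl⟩ := h
      · have := extD_dForm (algebraMap R K a)
        rw [dForm] at this
        rw [this]; exact zero_mem _
      · have := extD_dlog (algebraMap R K u)
        rw [dForm, ← Algebra.smul_def, ← map_smul] at this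
        rw [this]; exact zero_mem _
    | zero => simp
    | add x y _ _ hx hy => rw [map_add, map_add]; exact add_mem hx hy
    | smul a x hx ih =>
      have e : ExteriorAlgebra.ι K (a • x) = a • ExteriorAlgebra.ι K x :=
        ((ExteriorAlgebra.ι K).restrictScalars R).map_smul a x
      rw [e, extD_smul]
      refine add_mem ?_ (Submodule.smul_mem _ _ ih)
      rw [logForms_succ]
      refine Submodule.mul_mem_mul (dForm_mem E a) ?_
      rw [logForms_one]
      exact ⟨x, hx, rfl⟩
  induction q with
  | zero =>
    intro w hw
    rw [logForms, pow_zero, Submodule.mem_one] at hw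
    obtain ⟨a, rfl⟩ := hw
    rw [IsScalarTower.algebraMap_apply R K (Forms K), extD_algebraMap]
    exact dForm_mem E a
  | succ q ih =>
    intro w hw
    rw [logForms_succ] at hw
    induction hw using Submodule.mul_induction_on' with
    | mem_mul_mem v hv w hw =>
      rw [extD_mul, (h1 v hv).2, neg_mul]
      refine add_mem ?_ (neg_mem ?_)
      · have := Submodule.mul_mem_mul (h1 v hv).1 hw
        rwa [logForms, logForms, ← pow_add, add_comm 2 q] at this
      · rw [logForms_succ]
        exact Submodule.mul_mem_mul hv (ih w hw)
    | add x _ y _ hx hy => rw [map_add]; exact add_mem hx hy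

/-- The exterior derivative respects the twist by `D` when `D` is principal and its zero locus is
contained in that of `E`. -/
lemma extD_mem_twistedLogForms {E D : Ideal R} (hD : D.IsPrincipal) (h : E ≤ D.radical) (q : ℕ)
    (w : Forms K) (hw : w ∈ twistedLogForms K E D q) :
    extD w ∈ twistedLogForms K E D (q + 1) := by
  obtain ⟨g, rfl⟩ := hD
  change E ≤ (Ideal.span {g}).radical at h
  change w ∈ Ideal.span {g} • _ at hw
  change _ ∈ Ideal.span {g} • _
  rw [Submodule.ideal_span_singleton_smul] at hw ⊢
  obtain ⟨v, hv, rfl⟩ := hw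
  change extD (g • v) ∈ _
  rw [extD_smul]
  refine add_mem ?_ (Submodule.smul_mem_pointwise_smul _ _ _ (extD_mem_logForms E q v hv))
  have e : dForm (algebraMap R K g) * v =
      g • ((algebraMap K (Forms K) (algebraMap R K g)⁻¹ * dForm (algebraMap R K g)) * v) := by
    by_cases h0 : algebraMap R K g = 0
    · simp [h0, dForm_zero]
    · rw [← algebraMap_smul K g, Algebra.smul_def, ← mul_assoc, ← mul_assoc, ← map_mul,
        mul_inv_cancel₀ h0, map_one, one_mul]
  rw [e]
  refine Submodule.smul_mem_pointwise_smul _ _ _ ?_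
  rw [logForms_succ]
  exact Submodule.mul_mem_mul (inv_mul_dForm_mem h) hv

end LogForms

section SubsheafOfConstant

variable {X : TopCat.{u}} {G : Type u} [AddCommGroup G]

/-- The locally constant functions `s : U → G` with `s y ∈ N y` for all `y` in `U`. -/
def latticeSections (N : X → AddSubgroup G) (U : Opens X) : AddSubgroup (U → G) where
  carrier := {s | IsLocallyConstant s ∧ ∀ y : U, s y ∈ N y}
  zero_mem' := ⟨IsLocallyConstant.const 0, fun y => zero_mem (N y)⟩
  add_mem' := fun hs ht => ⟨hs.1.add ht.1, fun y => add_mem (hs.2 y) (ht.2 y)⟩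
  neg_mem' := fun hs => ⟨hs.1.neg, fun y => neg_mem (hs.2 y)⟩

/-- Restriction of sections. -/
def latticeRes (N : X → AddSubgroup G) {U V : Opens X} (h : V ≤ U) :
    latticeSections N U →+ latticeSections N V where
  toFun s := ⟨fun y => s.1 ⟨y.1, h y.2⟩,
    s.2.1.comp_continuous (Opens.isOpenEmbedding_of_le h).continuous, fun y => s.2.2 ⟨y.1, h y.2⟩⟩
  map_zero' := rfl
  map_add' _ _ := rfl

/-- The presheaf of the sections `latticeSections N`. -/
def latticePresheaf (N : X → AddSubgroup G) : TopCat.Presheaf AddCommGrpCat.{u} X where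
  obj U := AddCommGrpCat.of (latticeSections N U.unop)
  map i := AddCommGrpCat.ofHom (latticeRes N i.unop.le)

/-- The condition defining `latticeSections N` is local. -/
def latticePredicate (N : X → AddSubgroup G) : TopCat.LocalPredicate (fun _ : X => G) where
  pred {U} s := s ∈ latticeSections N U
  res i _ hs := (latticeRes N i.le ⟨_, hs⟩).2
  locality {U} s hs := by
    refine ⟨?_, fun y => ?_⟩
    · rw [IsLocallyConstant.iff_exists_open]
      intro y
      obtain ⟨V, hy, i, h1, -⟩ := hs y
      obtain ⟨W, hW, hyW, hc⟩ := (IsLocallyConstant.iff_exists_open _).1 h1 ⟨y.1, hy⟩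
      have hW' : IsOpen (Subtype.val '' W : Set X) := V.2.isOpenMap_subtype_val W hW
      refine ⟨Subtype.val ⁻¹' (Subtype.val '' W), hW'.preimage continuous_subtype_val,
        ⟨_, hyW, rfl⟩, ?_⟩
      rintro ⟨z, hz⟩ ⟨z', hz', rfl⟩
      exact hc z' hz'
    · obtain ⟨V, hy, i, -, h2⟩ := hs y
      exact h2 ⟨y.1, hy⟩

lemma latticePresheaf_isSheaf (N : X → AddSubgroup G) : (latticePresheaf N).IsSheaf := by
  rw [TopCat.Presheaf.isSheaf_iff_isSheaf_comp (forget AddCommGrpCat.{u})]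
  exact TopCat.subpresheafToTypes.isSheaf (latticePredicate N)

/-- The sheaf of abelian groups whose sections over `U` are the locally constant functions
`s : U → G` with `s y ∈ N y` for all `y` in `U`. On an irreducible space this is a subsheaf of
the constant sheaf `G`: over a nonempty open `U` the sections are the elements of `⋂_{y ∈ U} N y`.
-/
def latticeSheaf (N : X → AddSubgroup G) : TopCat.Sheaf AddCommGrpCat.{u} X :=
  ⟨latticePresheaf N, latticePresheaf_isSheaf N⟩

/-- The map of sheaves induced by an additive map `G → G` that sends each `N y` to `N' y`. -/
def latticeMap {N N' : X → AddSubgroup G} (f : G →+ G) (hf : ∀ y, ∀ w ∈ N y, f w ∈ N' y) :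
    latticeSheaf N ⟶ latticeSheaf N' where
  hom :=
    { app := fun _ => AddCommGrpCat.ofHom
        { toFun := fun s => ⟨fun y => f (s.1 y), s.2.1.comp f, fun y => hf y _ (s.2.2 y)⟩
          map_zero' := Subtype.ext (funext fun _ => map_zero f)
          map_add' := fun _ _ => Subtype.ext (funext fun _ => map_add f _ _) }
      naturality := fun _ _ _ => rfl }

lemma latticeMap_comp {N N' N'' : X → AddSubgroup G} (f g h : G →+ G)
    (hf : ∀ y, ∀ w ∈ N y, f w ∈ N' y) (hg : ∀ y, ∀ w ∈ N' y, g w ∈ N'' y)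
    (hh : ∀ y, ∀ w ∈ N y, h w ∈ N'' y) (e : ∀ w, g (f w) = h w) :
    latticeMap f hf ≫ latticeMap g hg = latticeMap h hh := by
  apply CategoryTheory.Sheaf.hom_ext
  ext U s
  exact Subtype.ext (funext fun _ => e _)

lemma latticeMap_zero {N N' : X → AddSubgroup G} :
    latticeMap (N := N) (N' := N') 0 (fun y _ _ => zero_mem (N' y)) = 0 := rfl

end SubsheafOfConstant

section Divisors

variable {Y : Scheme.{u}}

/-- The stalk at `y` of an ideal sheaf, as an ideal of the local ring at `y`. -/
def stalkIdeal (I : Y.IdealSheafData) (y : Y) : Ideal (Y.presheaf.stalk y) :=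
  ⨆ (U : Y.affineOpens) (hy : y ∈ U.1), (I.ideal U).map (Y.presheaf.germ U.1 y hy).hom

lemma stalkIdeal_eq (I : Y.IdealSheafData) (y : Y) (U : Y.affineOpens) (hy : y ∈ U.1) :
    stalkIdeal I y = (I.ideal U).map (Y.presheaf.germ U.1 y hy).hom := by
  have key : ∀ (V W : Y.affineOpens) (hV : y ∈ V.1) (hW : y ∈ W.1),  W ≤ V →
      (I.ideal V).map (Y.presheaf.germ V.1 y hV).hom =
        (I.ideal W).map (Y.presheaf.germ W.1 y hW).hom := by
    intro V W hV hW h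
    rw [← I.map_ideal h, Ideal.map_map, ← CommRingCat.hom_comp]
    exact congrArg (fun g => (I.ideal V).map (CommRingCat.Hom.hom g))
      (Y.presheaf.germ_res (homOfLE h) y hW).symm
  refine le_antisymm (iSup₂_le fun V hV => ?_) (le_iSup₂_of_le U hy le_rfl)
  obtain ⟨W, hW, hyW, hWU⟩ := Y.isBasis_affineOpens.exists_subset_of_mem_open
    (show y ∈ ((U.1 ⊓ V.1 : Y.Opens) : Set Y) from ⟨hy, hV⟩) (U.1 ⊓ V.1).2
  obtain ⟨W, hW', rfl⟩ := hW
  rw [key V ⟨W, hW'⟩ hV hyW (fun z hz => (hWU hz).2),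
    key U ⟨W, hW'⟩ hy hyW (fun z hz => (hWU hz).1)]

lemma exists_affine (y : Y) : ∃ U : Y.affineOpens, y ∈ U.1 := by
  obtain ⟨_, ⟨W, hW', rfl⟩, hyW, -⟩ := Y.isBasis_affineOpens.exists_subset_of_mem_open
    (Set.mem_univ y) isOpen_univ
  exact ⟨⟨W, hW'⟩, hyW⟩

lemma stalkIdeal_mono {I J : Y.IdealSheafData} (h : I ≤ J) (y : Y) :
    stalkIdeal I y ≤ stalkIdeal J y :=
  iSup₂_mono fun U _ => Ideal.map_mono (h U)

lemma stalkIdeal_mul (I J : Y.IdealSheafData) (y : Y) :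
    stalkIdeal (I * J) y = stalkIdeal I y * stalkIdeal J y := by
  obtain ⟨U, hU⟩ := exists_affine y
  rw [stalkIdeal_eq _ y U hU, stalkIdeal_eq _ y U hU, stalkIdeal_eq _ y U hU, ← Ideal.map_mul]
  rfl

lemma stalkIdeal_radical_le (I : Y.IdealSheafData) (y : Y) :
    stalkIdeal I.radical y ≤ (stalkIdeal I y).radical := by
  obtain ⟨U, hU⟩ := exists_affine y
  rw [stalkIdeal_eq _ y U hU, stalkIdeal_eq _ y U hU]
  exact Ideal.map_radical_le _

/-- An effective Cartier divisor, given by its ideal sheaf: locally the ideal is generated by one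
nonzerodivisor. -/
def IsEffectiveCartier (D : Y.IdealSheafData) : Prop :=
  ∀ y : Y, ∃ U : Y.affineOpens, y ∈ U.1 ∧
    ∃ f ∈ nonZeroDivisors Γ(Y, U.1), D.ideal U = Ideal.span {f}

/-- A (reduced) simple normal crossing divisor, given by its ideal sheaf: at every point `y` of the
divisor the local ring is regular, with a regular system of parameters
`x_1, …, x_n` such that the divisor is defined at `y` by a product of distinct `x_j`. -/
def IsSimpleNormalCrossing (E : Y.IdealSheafData) : Prop :=
  ∀ y ∈ E.support, IsRegularLocalRing (Y.presheaf.stalk y) ∧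
    ∃ (n : ℕ) (x : Fin n → Y.presheaf.stalk y) (J : Finset (Fin n)),
      (n : WithBot ℕ∞) = ringKrullDim (Y.presheaf.stalk y) ∧
      Ideal.span (Set.range x) = IsLocalRing.maximalIdeal (Y.presheaf.stalk y) ∧
      stalkIdeal E y = Ideal.span {∏ j ∈ J, x j}

/-- The irreducible components of the support of a divisor. -/
def components (D : Y.IdealSheafData) : Set (Set Y) :=
  {Z | Maximal (fun Z => IsIrreducible Z ∧ Z ⊆ (D.support : Set Y)) Z}

/-- The multiplicity of the divisor `D` at a point `η`, used for the generic points of the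
components of `D`: the length of the local ring of `D` at `η`. -/
def multiplicity (D : Y.IdealSheafData) (η : Y) : ℕ∞ :=
  Module.length (Y.presheaf.stalk η) (Y.presheaf.stalk η ⧸ stalkIdeal D η)

end Divisors
section Complex

variable {Y : Scheme.{u}}

lemma isPrincipal_of_mul_eq {R : Type u} [CommRing R] [IsDomain R] [IsLocalRing R] {I J : Ideal R}
    {x : R} (hx : x ≠ 0) (h : I * J = Ideal.span {x}) : I.IsPrincipal := by
  by_contra hI
  have key : ∀ i ∈ I, ∀ j ∈ J, i * j ∈ Ideal.span {x} * IsLocalRing.maximalIdeal R := by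
    intro i hi j hj
    obtain ⟨c, hc⟩ := Ideal.mem_span_singleton'.1 (h ▸ Ideal.mul_mem_mul hi hj)
    rw [Ideal.mem_span_singleton_mul]
    refine ⟨c, ?_, by rw [← hc, mul_comm]⟩
    rw [IsLocalRing.mem_maximalIdeal, mem_nonunits_iff]
    rintro ⟨v, rfl⟩
    have hj0 : j ≠ 0 := by
      rintro rfl
      rw [mul_zero] at hc
      exact hx ((mul_eq_zero.1 hc).resolve_left v.ne_zero)
    refine hI ⟨i, le_antisymm (fun a ha => ?_) ((Ideal.span_singleton_le_iff_mem I).2 hi)⟩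
    obtain ⟨b, hb⟩ := Ideal.mem_span_singleton'.1 (h ▸ Ideal.mul_mem_mul ha hj)
    refine Ideal.mem_span_singleton'.2 ⟨b * ↑v⁻¹, mul_right_cancel₀ hj0 ?_⟩
    rw [mul_assoc, ← hc, ← hb, mul_assoc, ← mul_assoc _ _ x, Units.inv_mul, one_mul]
  have hle : I * J ≤ Ideal.span {x} * IsLocalRing.maximalIdeal R := Ideal.mul_le.2 key
  rw [h] at hle
  obtain ⟨c, hc, hcx⟩ := Ideal.mem_span_singleton_mul.1 (hle (Ideal.mem_span_singleton_self x))
  have : c = 1 := mul_left_cancel₀ hx (by rw [hcx, mul_one])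
  subst this
  exact (IsLocalRing.mem_maximalIdeal _).1 hc isUnit_one

/-- The ideal sheaf `D` is locally principal, and its zero locus is contained in that of `E`. -/
def IsLogTwist (E D : Y.IdealSheafData) : Prop :=
  ∀ y : Y, (stalkIdeal D y).IsPrincipal ∧ stalkIdeal E y ≤ (stalkIdeal D y).radical

/-- The condition on a pair of divisors `F` and `D`: `F` is a reduced simple normal crossing
divisor, `D` is an effective Cartier divisor, they have no common component and
`D_red + F` is a reduced simple normal crossing divisor. Divisors are given by their ideal sheaves,
so that sums are products and `D_red` is the radical. -/
structure IsModulusPair (F D : Y.IdealSheafData) : Prop where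
  snc_face : IsSimpleNormalCrossing F
  cartier : IsEffectiveCartier D
  no_common_component : Disjoint (components D) (components F)
  snc_sum : IsSimpleNormalCrossing (D.radical * F)

lemma stalkIdeal_isPrincipal {D : Y.IdealSheafData} (hD : IsEffectiveCartier D) (y : Y) :
    (stalkIdeal D y).IsPrincipal := by
  obtain ⟨U, hU, f, -, hf⟩ := hD y
  rw [stalkIdeal_eq _ y U hU, hf, Ideal.map_span, Set.image_singleton]
  exact ⟨_, rfl⟩

lemma stalkIdeal_ne_bot [IsIntegral Y] {D : Y.IdealSheafData} (hD : IsEffectiveCartier D) (y : Y) :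
    stalkIdeal D y ≠ ⊥ := by
  obtain ⟨U, hU, f, hf0, hf⟩ := hD y
  have : Nonempty U.1 := ⟨⟨y, hU⟩⟩
  rw [stalkIdeal_eq _ y U hU, hf, Ideal.map_span, Set.image_singleton, Ne,
    Ideal.span_singleton_eq_bot]
  intro h
  exact nonZeroDivisors.ne_zero hf0
    (germ_injective_of_isIntegral Y y hU (h.trans (map_zero _).symm))

lemma stalkIdeal_eq_top {E : Y.IdealSheafData} {y : Y} (h : y ∉ E.support) :
    stalkIdeal E y = ⊤ := by
  obtain ⟨U, hU⟩ := exists_affine y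
  rw [E.mem_support_iff_of_mem hU, Scheme.mem_zeroLocus_iff] at h
  push Not at h
  obtain ⟨f, hf, hy⟩ := h
  rw [stalkIdeal_eq _ y U hU]
  exact Ideal.eq_top_of_isUnit_mem _ (Ideal.mem_map_of_mem _ hf)
    ((Y.mem_basicOpen f y hU).1 hy)

lemma regularSystem_ne_zero {R : Type u} [CommRing R] [IsRegularLocalRing R] {n : ℕ}
    {x : Fin n → R} (hn : (n : WithBot ℕ∞) = ringKrullDim R)
    (hx : Ideal.span (Set.range x) = IsLocalRing.maximalIdeal R) (j : Fin n) : x j ≠ 0 := by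
  intro h0
  have h1 : Ideal.span (x '' (Set.univ \ {j})) = IsLocalRing.maximalIdeal R := by
    rw [← hx]
    refine le_antisymm (Ideal.span_mono (Set.image_subset_range _ _)) (Ideal.span_le.2 ?_)
    rintro _ ⟨i, rfl⟩
    by_cases hij : i = j
    · subst hij; rw [h0]; exact zero_mem _
    · exact Ideal.subset_span ⟨i, ⟨trivial, hij⟩, rfl⟩
  have h2 := Submodule.spanFinrank_span_le_ncard_of_finite (R := R)
    (Set.toFinite (x '' (Set.univ \ {j})))
  rw [show Submodule.span R (x '' (Set.univ \ {j})) = IsLocalRing.maximalIdeal R from h1] at h2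
  have h3 : (x '' (Set.univ \ {j})).ncard < n := by
    refine (Set.ncard_image_le (Set.toFinite _)).trans_lt ?_
    rw [Set.ncard_sdiff_singleton_of_mem (Set.mem_univ j), Set.ncard_univ, Nat.card_eq_fintype_card,
      Fintype.card_fin]
    exact Nat.sub_lt (Fin.pos j) one_pos
  have h4 := IsRegularLocalRing.spanFinrank_maximalIdeal (R := R)
  rw [← hn] at h4
  have h5 : (IsLocalRing.maximalIdeal R).spanFinrank = n := by exact_mod_cast h4
  omega

lemma isSNC_stalk [IsIntegral Y] {E : Y.IdealSheafData} (hE : IsSimpleNormalCrossing E) (y : Y) :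
    ∃ x : Y.presheaf.stalk y, x ≠ 0 ∧ stalkIdeal E y = Ideal.span {x} := by
  by_cases hy : y ∈ E.support
  · obtain ⟨hr, n, x, J, hn, hx, h⟩ := hE y hy
    exact ⟨_, Finset.prod_ne_zero_iff.2 fun j _ => regularSystem_ne_zero hn hx j, h⟩
  · exact ⟨1, one_ne_zero, by rw [stalkIdeal_eq_top hy, Ideal.span_singleton_one]⟩

lemma IsModulusPair.le_radical {F D : Y.IdealSheafData} (y : Y) :
    stalkIdeal (D.radical * F) y ≤ (stalkIdeal D y).radical := by
  rw [stalkIdeal_mul]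
  exact Ideal.mul_le_left.trans (stalkIdeal_radical_le D y)

lemma IsModulusPair.isLogTwist {F D : Y.IdealSheafData} (h : IsModulusPair F D) :
    IsLogTwist (D.radical * F) D :=
  fun y => ⟨stalkIdeal_isPrincipal h.cartier y, le_radical y⟩

lemma IsModulusPair.isLogTwist_radical [IsIntegral Y] {F D : Y.IdealSheafData}
    (h : IsModulusPair F D) : IsLogTwist (D.radical * F) D.radical := by
  refine fun y => ⟨?_, ?_⟩
  · obtain ⟨x, hx, e⟩ := isSNC_stalk h.snc_sum y
    rw [stalkIdeal_mul] at e
    exact isPrincipal_of_mul_eq hx e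
  · exact (le_radical y).trans (Ideal.radical_mono (stalkIdeal_mono D.le_radical y))

variable [IsIntegral Y]

/-- The stalk at `y` of `Ω^q_Y(log E)(-D)`, inside the rational `q`-forms on `Y`: the product of
the stalk of the ideal sheaf of `D` and the `q`-fold wedge products of logarithmic one-forms. -/
def logStalk (E D : Y.IdealSheafData) (q : ℕ) (y : Y) : AddSubgroup (Forms Y.functionField) :=
  (twistedLogForms Y.functionField (stalkIdeal E y) (stalkIdeal D y) q).toAddSubgroup

/-- The sheaf `Ω^q_Y(log E)(-D)` for absolute differentials. Its sections over a nonempty `U` are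
the rational `q`-forms that lie in the stalk at every point of `U`. For `Y` integral and smooth
over a field, the forms on the complement `X` of `E` embed into the rational forms, and this is
the subsheaf of `j_* Ω^q_X`, for `j : X → Y`, of forms with logarithmic poles, times `𝒪(-D)`. -/
def logSheaf (E D : Y.IdealSheafData) (q : ℕ) : TopCat.Sheaf AddCommGrpCat.{u} Y :=
  latticeSheaf (X := Y.toPresheafedSpace.carrier) (logStalk E D q)

lemma extD_mem_logStalk {E D : Y.IdealSheafData} (h : IsLogTwist E D) (q : ℕ) (y : Y) :
    ∀ w ∈ logStalk E D q y, extD w ∈ logStalk E D (q + 1) y :=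
  fun w hw => extD_mem_twistedLogForms (h y).1 (h y).2 q w hw

/-- The exterior derivative `Ω^q_Y(log E)(-D) → Ω^{q+1}_Y(log E)(-D)`. -/
def logD {E D : Y.IdealSheafData} (h : IsLogTwist E D) (q : ℕ) :
    logSheaf E D q ⟶ logSheaf E D (q + 1) :=
  latticeMap extD (extD_mem_logStalk h q)

lemma logD_comp {E D : Y.IdealSheafData} (h : IsLogTwist E D) (q : ℕ) :
    logD h q ≫ logD h (q + 1) = 0 :=
  (latticeMap_comp extD extD 0 (extD_mem_logStalk h q) (extD_mem_logStalk h (q + 1))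
    (fun y _ _ => zero_mem (logStalk E D (q + 2) y)) extD_extD).trans latticeMap_zero

/-- The relative de Rham complex `Ω^•_Y(log E)(-D)`, a complex of sheaves of abelian groups for
the Zariski topology of `Y`. -/
def relDeRham {E D : Y.IdealSheafData} (h : IsLogTwist E D) :
    CochainComplex (TopCat.Sheaf AddCommGrpCat.{u} Y) ℕ :=
  CochainComplex.of (logSheaf E D) (logD h) (logD_comp h)

lemma logStalk_mono (E : Y.IdealSheafData) {D D' : Y.IdealSheafData} (hle : D ≤ D') (q : ℕ)
    (y : Y) : ∀ w ∈ logStalk E D q y, AddMonoidHom.id _ w ∈ logStalk E D' q y :=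
  fun _ hw => twistedLogForms_mono _ (stalkIdeal_mono hle y) q hw

/-- The inclusion `Ω^•_Y(log E)(-D) → Ω^•_Y(log E)(-D')`, if the ideal of `D` is contained in
that of `D'`. -/
def relDeRhamInclusion {E D D' : Y.IdealSheafData} (h : IsLogTwist E D) (h' : IsLogTwist E D')
    (hle : D ≤ D') : relDeRham h ⟶ relDeRham h' :=
  CochainComplex.ofHom
    (fun q => latticeMap (AddMonoidHom.id _) (logStalk_mono E hle q)) (fun q => by
      refine (congrArg _ (CochainComplex.of_d ..)).trans
        (Eq.trans ?_ (congrArg (· ≫ _) (CochainComplex.of_d ..).symm))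
      have hm := fun y w hw => logStalk_mono E hle (q + 1) y _ (extD_mem_logStalk h q y w hw)
      exact (latticeMap_comp _ _ extD _ _ hm fun _ => rfl).trans
        (latticeMap_comp _ _ extD _ _ hm fun _ => rfl).symm)

end Complex

end

end LogDeRham

/-! The inclusion is injective in each degree, so the point is that its cokernel is acyclic. This is
checked at each point and proved there with a Lie derivative.

At a point of E = D_red + F, let x_j be the coordinates whose product defines E. The ideals of D_red
and D are generated by monomials in the x_j with the same support. Pass from the first to the second
by multiplying by one coordinate at a time. It then suffices that Ω(log E)(-a) / Ω(log E)(-at) is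
acyclic when t = x_i and a is a monomial in which t has an exponent m with 1 ≤ m < e_i.

Let δ be a derivation of the local ring with δ(x_i) = 1 and δ(x_j) = 0 for the other coordinates of
E, and let ι be the contraction with the logarithmic vector field tδ. It preserves logarithmic
forms. If u is invertible away from E, then tδ(u)/u = tr + n with an integer n, and d(tr + n) = t(dr
+ r dt/t). Hence L = dι + ιd sends Ω^q(log E) into tΩ^q(log E). Since tδ(a) = ma, one has L(av) =
mav + aL(v), so L is multiplication by m on the quotient, and it is null-homotopic. The bound e_i <
p makes m invertible, and the quotient is acyclic (`IsLogFunctional.isRelAcyclic`,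
`isRelAcyclic_monomial`).

Three facts feed this argument. The derivation δ exists because one may work over the prime field:
it is perfect, so the residue field is formally smooth over it and the conormal sequence splits
(`exists_derivation_of_span_eq_maximalIdeal`). The formula for tδ(u)/u holds because the coordinates
are prime elements, so that u is a unit times a monomial (`prime_of_span_eq_maximalIdeal`). The
exponent e_j is at most the multiplicity of a component of D through the point
(`exists_component_le_multiplicity`).

Pointwise acyclicity gives the statement on sheaves because a form in one stalk lies in the stalks
at all nearby points (`isSpreading_logStalk`, `lattice_refinement`). -/

open CategoryTheory TopologicalSpace AlgebraicGeometry

/-! ### Monomorphisms of complexes with acyclic cokernel -/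

section Refinement

open HomologicalComplex Limits

variable {C : Type*} [Category C] [Abelian C]

/-- A degreewise monomorphism of cochain complexes is a quasi-isomorphism if its cokernel is
acyclic, expressed up to refinements. -/
lemma CochainComplex.quasiIso_of_mono_of_refinements {K L : CochainComplex C ℕ} (φ : K ⟶ L)
    [hm : ∀ q, Mono (φ.f q)]
    (h : ∀ (q : ℕ) ⦃A : C⦄ (x : A ⟶ L.X q) (y : A ⟶ K.X (q + 1)),
      x ≫ L.d q (q + 1) = y ≫ φ.f (q + 1) →
      ∃ (A' : C) (π : A' ⟶ A) (_ : Epi π) (a : A' ⟶ K.X q) (i : ℕ) (b : A' ⟶ L.X i),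
        π ≫ x = a ≫ φ.f q + b ≫ L.d i q) : QuasiIso φ := by
  refine ⟨fun q => ?_⟩
  rw [quasiIsoAt_iff_isIso_homologyMap]
  have hnext : (ComplexShape.up ℕ).next q = q + 1 := by simp
  have h1 : Mono (homologyMap φ q) := by
    rw [mono_homologyMap_iff_up_to_refinements φ _ q (q + 1) rfl hnext]
    intro A x hx y hy
    -- Injectivity on homology: if φ(x) = dy and y = φ(a) + db, then φ(x) = φ(da), so x = da.
    by_cases hq : (ComplexShape.up ℕ).Rel ((ComplexShape.up ℕ).prev q) q
    · generalize (ComplexShape.up ℕ).prev q = i at hq y hy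
      obtain rfl : i + 1 = q := hq
      obtain ⟨A', π, hπ, a, j, b, e⟩ := h i y x hy.symm
      refine ⟨A', π, hπ, a, ?_⟩
      rw [← cancel_mono (φ.f (i + 1)), Category.assoc, hy, ← Category.assoc, e]
      simp
    -- In degree 0 there is no incoming differential, so φ(x) = 0 and x = 0.
    · refine ⟨A, 𝟙 A, inferInstance, 0, ?_⟩
      rw [L.shape _ _ hq, comp_zero] at hy
      rw [← cancel_mono (φ.f q), Category.assoc, hy]
      simp
  have h2 : Epi (homologyMap φ q) := by
    rw [epi_homologyMap_iff_up_to_refinements φ _ q (q + 1) rfl hnext]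
    intro A x hx
    -- Surjectivity on homology: a cocycle x has dx = 0, which comes from the smaller complex, and
    -- then x = φ(a) + db with a again a cocycle.
    obtain ⟨A', π, hπ, a, j, b, e⟩ := h q x 0 (by rw [hx, zero_comp])
    have ha : a ≫ K.d q (q + 1) = 0 := by
      rw [← cancel_mono (φ.f (q + 1)), Category.assoc, ← φ.comm, ← Category.assoc,
        ← sub_eq_iff_eq_add.2 e, Preadditive.sub_comp]
      simp [hx]
    by_cases hj : (ComplexShape.up ℕ).Rel j q
    · obtain rfl := (ComplexShape.up ℕ).prev_eq' hj
      exact ⟨A', π, hπ, a, ha, b, e⟩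
    · rw [L.shape _ _ hj, comp_zero] at e
      exact ⟨A', π, hπ, a, ha, 0, by rw [e, zero_comp]⟩
  exact isIso_of_mono_of_epi _

end Refinement

/-! ### Local surjectivity for lattice sheaves -/

namespace LogDeRham
noncomputable section

section LatticeSheaves

variable {X : TopCat.{u}} {G : Type u} [AddCommGroup G]

/-- A family of subgroups is spreading if an element of one of them belongs to all the
neighbouring ones. The stalks of `latticeSheaf N` are then the groups `N y`. -/
def IsSpreading (N : X → AddSubgroup G) : Prop :=
  ∀ y, ∀ w ∈ N y, ∃ U : Opens X, y ∈ U ∧ ∀ z ∈ U, w ∈ N z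

/-- The section of a lattice sheaf given by a constant function. -/
def latticeConst {N : X → AddSubgroup G} {U : Opens X} (w : G) (h : ∀ z ∈ U, w ∈ N z) :
    latticeSections N U :=
  ⟨fun _ => w, IsLocallyConstant.const w, fun z => h z.1 z.2⟩

lemma latticeMap_mono {N N' : X → AddSubgroup G} (f : G →+ G) (hf : ∀ y, ∀ w ∈ N y, f w ∈ N' y)
    (hi : Function.Injective f) : Mono (latticeMap f hf) where
  right_cancellation {A} a b e := by
    apply CategoryTheory.Sheaf.hom_ext
    ext U s
    have e' := congrArg (fun g : A ⟶ latticeSheaf N' => (g.hom.app U s)) e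
    exact Subtype.ext (funext fun z => hi (congrFun (congrArg Subtype.val e') z))

/-- The function underlying a section of a lattice sheaf. -/
def latticeValue {N : X → AddSubgroup G} {U : (Opens X)ᵒᵖ} (s : (latticeSheaf N).obj.obj U) :
    latticeSections N U.unop := s

/-- Lifting a morphism to a smaller lattice sheaf. -/
def latticeLift {N N' : X → AddSubgroup G} {A : TopCat.Sheaf AddCommGrpCat.{u} X}
    (x : A ⟶ latticeSheaf N')
    (h : ∀ (U : (Opens X)ᵒᵖ) (s : A.obj.obj U) (z : U.unop),
      (latticeValue (x.hom.app U s)).1 z ∈ N z.1) :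
    A ⟶ latticeSheaf N where
  hom :=
    { app := fun U => AddCommGrpCat.ofHom
        { toFun := fun s => ⟨(latticeValue (x.hom.app U s)).1,
            (latticeValue (x.hom.app U s)).2.1, h U s⟩
          map_zero' := Subtype.ext <| by
            have := congrArg (fun v => (latticeValue v).1)
              (map_zero (ConcreteCategory.hom (x.hom.app U)))
            exact this
          map_add' := fun s t => Subtype.ext <| by
            have := congrArg (fun v => (latticeValue v).1)
              (map_add (ConcreteCategory.hom (x.hom.app U)) s t)
            exact this }
      naturality := fun U V i => by
        ext s
        refine Subtype.ext ?_
        have := congrArg (fun g => (latticeValue ((ConcreteCategory.hom g) s)).1)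
          (x.hom.naturality i)
        exact this }

lemma latticeLift_comp {N N' : X → AddSubgroup G} {A : TopCat.Sheaf AddCommGrpCat.{u} X}
    (x : A ⟶ latticeSheaf N') (h) (hi : ∀ y, ∀ w ∈ N y, AddMonoidHom.id G w ∈ N' y) :
    latticeLift (N := N) x h ≫ latticeMap (AddMonoidHom.id G) hi = x := by
  apply CategoryTheory.Sheaf.hom_ext
  ext U s
  rfl

-- Passage from points to sheaves: the decomposition w = (w - f v) + f v at a point persists on a
-- neighbourhood, because sections are locally constant and the families `N` and `P` spread. The map
-- f is the differential, or 0 in degree zero.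
open Limits in
lemma lattice_refinement {N N' N'' Q P : X → AddSubgroup G} (d f : G →+ G)
    (hN : ∀ y, ∀ w ∈ N y, AddMonoidHom.id G w ∈ N' y)
    (hN'' : ∀ y, ∀ w ∈ N'' y, AddMonoidHom.id G w ∈ Q y)
    (hd : ∀ y, ∀ w ∈ N' y, d w ∈ Q y) (hdN : ∀ y, ∀ w ∈ N y, d w ∈ N'' y)
    (hf : ∀ y, ∀ w ∈ P y, f w ∈ N' y) (hdf : ∀ w, d (f w) = 0)
    (sN : IsSpreading N) (sP : IsSpreading P)
    (hac : ∀ y, ∀ w ∈ N' y, d w ∈ N'' y → ∃ v ∈ P y, w - f v ∈ N y)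
    {A : TopCat.Sheaf AddCommGrpCat.{u} X} (x : A ⟶ latticeSheaf N') (z : A ⟶ latticeSheaf N'')
    (e : x ≫ latticeMap d hd = z ≫ latticeMap (AddMonoidHom.id G) hN'') :
    ∃ (A' : TopCat.Sheaf AddCommGrpCat.{u} X) (π : A' ⟶ A) (_ : Epi π)
      (a : A' ⟶ latticeSheaf N) (b : A' ⟶ latticeSheaf P),
      π ≫ x = a ≫ latticeMap (AddMonoidHom.id G) hN + b ≫ latticeMap f hf := by
  -- The preimage under d of the smaller complex. The section x factors through it, and the
  -- hypothesis `hac` says that N and f(P) generate it at each point.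
  let M : X → AddSubgroup G := fun y => N' y ⊓ (N'' y).comap d
  have hM : ∀ y, ∀ w ∈ M y, AddMonoidHom.id G w ∈ N' y := fun y w hw => hw.1
  have hNM : ∀ y, ∀ w ∈ N y, AddMonoidHom.id G w ∈ M y := fun y w hw => ⟨hN y w hw, hdN y w hw⟩
  have hPM : ∀ y, ∀ w ∈ P y, f w ∈ M y := fun y w hw => ⟨hf y w hw, by
    change d (f w) ∈ N'' y
    rw [hdf]; exact zero_mem _⟩
  let x' : A ⟶ latticeSheaf M := latticeLift x fun U s p => by
    refine ⟨(latticeValue (x.hom.app U s)).2.2 p, ?_⟩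
    have h1 := congrArg (fun g : A ⟶ latticeSheaf Q => g.hom.app U s) e
    have h2 := congrFun (congrArg Subtype.val h1) p
    have h3 := (latticeValue (z.hom.app U s)).2.2 p
    change d ((latticeValue (x.hom.app U s)).1 p) = (latticeValue (z.hom.app U s)).1 p at h2
    change d ((latticeValue (x.hom.app U s)).1 p) ∈ N'' p.1
    rw [h2]
    exact h3
  let ψ : latticeSheaf N ⊞ latticeSheaf P ⟶ latticeSheaf M :=
    biprod.desc (latticeMap (AddMonoidHom.id G) hNM) (latticeMap f hPM)
  have hψ : Epi ψ := by
    rw [← TopCat.Sheaf.isLocallySurjective_iff_epi, TopCat.Presheaf.isLocallySurjective_iff]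
    intro U t y hy
    obtain ⟨W, hW, hyW, hc⟩ := (IsLocallyConstant.iff_exists_open _).1
      (latticeValue t).2.1 ⟨y, hy⟩
    have hw := (latticeValue t).2.2 ⟨y, hy⟩
    set w : G := (latticeValue t).1 ⟨y, hy⟩ with hw_def
    obtain ⟨v, hv, hwv⟩ := hac y w hw.1 hw.2
    obtain ⟨V₁, hy₁, h₁⟩ := sP y v hv
    obtain ⟨V₂, hy₂, h₂⟩ := sN y _ hwv
    let W' : Opens X := ⟨Subtype.val '' W, U.2.isOpenMap_subtype_val W hW⟩
    have hW'U : W' ≤ U := by rintro _ ⟨p, -, rfl⟩; exact p.2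
    let V : Opens X := V₁ ⊓ V₂ ⊓ W'
    have hVU : V ≤ U := inf_le_right.trans hW'U
    let b : (latticeSheaf P).obj.obj (Opposite.op V) :=
      latticeConst v fun p hp => h₁ p hp.1.1
    let a : (latticeSheaf N).obj.obj (Opposite.op V) :=
      latticeConst (w - f v) fun p hp => h₂ p hp.1.2
    refine ⟨V, hVU, ⟨(biprod.inl (X := latticeSheaf N) (Y := latticeSheaf P)).hom.app _ a +
      (biprod.inr (X := latticeSheaf N) (Y := latticeSheaf P)).hom.app _ b, ?_⟩,
      ⟨⟨hy₁, hy₂⟩, ⟨⟨y, hy⟩, hyW, rfl⟩⟩⟩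
    rw [map_add]
    have e1 : ψ.hom.app (Opposite.op V)
        ((biprod.inl (X := latticeSheaf N) (Y := latticeSheaf P)).hom.app _ a) =
        (latticeMap (AddMonoidHom.id G) hNM).hom.app _ a :=
      congrArg (fun g : latticeSheaf N ⟶ latticeSheaf M => g.hom.app (Opposite.op V) a)
        (biprod.inl_desc (latticeMap (AddMonoidHom.id G) hNM) (latticeMap f hPM))
    have e2 : ψ.hom.app (Opposite.op V)
        ((biprod.inr (X := latticeSheaf N) (Y := latticeSheaf P)).hom.app _ b) =
        (latticeMap f hPM).hom.app _ b :=
      congrArg (fun g : latticeSheaf P ⟶ latticeSheaf M => g.hom.app (Opposite.op V) b)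
        (biprod.inr_desc (latticeMap (AddMonoidHom.id G) hNM) (latticeMap f hPM))
    rw [e1, e2]
    refine Subtype.ext (funext fun p => ?_)
    obtain ⟨p', hp', hpp⟩ := p.2.2
    have h3 := hc p' hp'
    have h4 : p' = ⟨p.1, hVU p.2⟩ := Subtype.ext hpp
    rw [h4] at h3
    change (w - f v) + f v = (latticeValue t).1 ⟨p.1, hVU p.2⟩
    rw [h3, sub_add_cancel]
  -- The refinement is the pullback of the epimorphism ψ along x'; its two components in N ⊞ P are
  -- the required a and b.
  refine ⟨pullback x' ψ, pullback.fst x' ψ, inferInstance, pullback.snd x' ψ ≫ biprod.fst,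
    pullback.snd x' ψ ≫ biprod.snd, ?_⟩
  have hx : x' ≫ latticeMap (AddMonoidHom.id G) hM = x := latticeLift_comp _ _ _
  have e1 : latticeMap (AddMonoidHom.id G) hNM ≫ latticeMap (AddMonoidHom.id G) hM =
      latticeMap (AddMonoidHom.id G) hN := latticeMap_comp _ _ _ _ _ _ fun _ => rfl
  have e2 : latticeMap f hPM ≫ latticeMap (AddMonoidHom.id G) hM =
      latticeMap f hf := latticeMap_comp _ _ _ _ _ _ fun _ => rfl
  rw [← hx, ← Category.assoc, pullback.condition, Category.assoc, Category.assoc, Category.assoc,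
    ← Preadditive.comp_add, ← e1, ← e2, ← Category.assoc biprod.fst, ← Category.assoc biprod.snd,
    ← Preadditive.add_comp]
  congr 2
  ext <;> simp [ψ]

end LatticeSheaves

end
end LogDeRham

/-! ### Reduction to acyclicity at each point -/

namespace LogDeRham
noncomputable section

section Criterion

variable {Y : Scheme.{u}} [IsIntegral Y]

/-- The inclusion of relative de Rham complexes is a quasi-isomorphism if its cokernel is
acyclic at every point, provided that the stalks spread. -/
lemma quasiIso_relDeRhamInclusion {E D D' : Y.IdealSheafData} (h : IsLogTwist E D)
    (h' : IsLogTwist E D') (hle : D ≤ D')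
    (sD : ∀ q, IsSpreading (X := Y.toPresheafedSpace.carrier) (logStalk E D q))
    (sD' : ∀ q, IsSpreading (X := Y.toPresheafedSpace.carrier) (logStalk E D' q))
    (hac : ∀ (y : Y) (q : ℕ), ∀ w ∈ logStalk E D' q y, extD w ∈ logStalk E D (q + 1) y →
      ∃ v, (q = 0 → v = 0) ∧ (∀ r, q = r + 1 → v ∈ logStalk E D' r y) ∧
        w - extD v ∈ logStalk E D q y) :
    QuasiIso (relDeRhamInclusion h h' hle) := by
  have hm : ∀ q, Mono ((relDeRhamInclusion h h' hle).f q) := fun q =>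
    latticeMap_mono (AddMonoidHom.id _) (logStalk_mono E hle q) fun _ _ e => e
  apply CochainComplex.quasiIso_of_mono_of_refinements
  intro q A x y e
  replace e : x ≫ logD h' q = y ≫ latticeMap (AddMonoidHom.id _) (logStalk_mono E hle (q + 1)) := by
    have hd : (relDeRham h').d q (q + 1) = logD h' q := CochainComplex.of_d ..
    rw [← hd]
    exact e
  cases q with
  | zero =>
    -- There are no primitives in degree 0, so f = 0 and any spreading family can serve as P.
    obtain ⟨A', π, hπ, a, b, e'⟩ := lattice_refinement (P := logStalk E D' 0) extD 0
      (logStalk_mono E hle 0) (logStalk_mono E hle 1) (extD_mem_logStalk h' 0)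
      (extD_mem_logStalk h 0) (fun y _ _ => zero_mem _) (fun _ => map_zero _) (sD 0) (sD' 0)
      (fun y w hw hdw => by
        obtain ⟨v, hv, -, hwv⟩ := hac y 0 w hw hdw
        rw [hv rfl] at hwv
        exact ⟨0, zero_mem _, by simpa using hwv⟩) x y e
    refine ⟨A', π, hπ, a, 0, 0, ?_⟩
    rw [Limits.zero_comp, add_zero]
    rw [latticeMap_zero, Limits.comp_zero, add_zero] at e'
    exact e'
  | succ r =>
    obtain ⟨A', π, hπ, a, b, e'⟩ := lattice_refinement (P := logStalk E D' r) extD extD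
      (logStalk_mono E hle (r + 1)) (logStalk_mono E hle (r + 2)) (extD_mem_logStalk h' (r + 1))
      (extD_mem_logStalk h (r + 1)) (extD_mem_logStalk h' r) extD_extD (sD (r + 1)) (sD' r)
      (fun y w hw hdw => by
        obtain ⟨v, -, hv, hwv⟩ := hac y (r + 1) w hw hdw
        exact ⟨v, hv r rfl, hwv⟩) x y e
    refine ⟨A', π, hπ, a, r, b, ?_⟩
    have hd : (relDeRham h').d r (r + 1) = logD h' r := CochainComplex.of_d ..
    rw [hd]
    exact e'

end Criterion

end
end LogDeRham

/-! ### Contraction and Lie derivative on rational forms -/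

namespace LogDeRham
noncomputable section

section LieDerivative

variable {K : Type u} [Field K] (l : Ω[K⁄ℤ] →ₗ[K] K)

/-- The contraction of forms by a linear functional on one-forms. -/
def contract : Forms K →ₗ[K] Forms K :=
  CliffordAlgebra.contractLeft (Q := (0 : QuadraticForm K (Ω[K⁄ℤ]))) l

lemma contract_algebraMap (a : K) : contract l (algebraMap K (Forms K) a) = 0 :=
  CliffordAlgebra.contractLeft_algebraMap _ l a

lemma contract_ι (x : Ω[K⁄ℤ]) :
    contract l (ExteriorAlgebra.ι K x) = algebraMap K (Forms K) (l x) :=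
  CliffordAlgebra.contractLeft_ι _ l x

lemma contract_ι_mul (x : Ω[K⁄ℤ]) (w : Forms K) :
    contract l (ExteriorAlgebra.ι K x * w) =
      l x • w - ExteriorAlgebra.ι K x * contract l w :=
  CliffordAlgebra.contractLeft_ι_mul l x w

lemma contract_mul (v w : Forms K) :
    contract l (v * w) = contract l v * w + CliffordAlgebra.involute v * contract l w := by
  induction v using ExteriorAlgebra.induction generalizing w with
  | algebraMap r =>
    rw [← Algebra.smul_def, map_smul, contract_algebraMap, AlgHom.commutes, ← Algebra.smul_def,
      zero_mul, zero_add]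
  | ι x =>
    rw [contract_ι_mul, contract_ι, involute_ι', ← Algebra.smul_def, neg_mul, sub_eq_add_neg]
  | mul a b ha hb => rw [mul_assoc, ha, hb, ha, map_mul, add_mul, mul_add]; noncomm_ring
  | add a b ha hb => rw [add_mul, map_add, ha, hb, map_add, map_add, add_mul, add_mul]; abel

lemma contract_involute (w : Forms K) :
    contract l (CliffordAlgebra.involute w) = -CliffordAlgebra.involute (contract l w) := by
  induction w using ExteriorAlgebra.induction with
  | algebraMap r => simp [contract_algebraMap]
  | ι x => simp [contract_ι]
  | mul a b ha hb => simp only [map_mul, contract_mul, ha, hb, map_add]; noncomm_ring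
  | add a b ha hb => simp only [map_add, ha, hb, neg_add]

/-- The Lie derivative of forms, given by the homotopy formula of Cartan. -/
def lieForm : Forms K →+ Forms K where
  toFun w := extD (contract l w) + contract l (extD w)
  map_zero' := by simp
  map_add' v w := by simp only [map_add]; abel

lemma lieForm_apply (w : Forms K) : lieForm l w = extD (contract l w) + contract l (extD w) := rfl

/-- Both d and the contraction are odd antiderivations, so their anticommutator is a derivation: the
signed cross terms cancel. -/
lemma lieForm_mul (v w : Forms K) : lieForm l (v * w) = lieForm l v * w + v * lieForm l w := by
  simp only [lieForm_apply, contract_mul, extD_mul, map_add, extD_involute, contract_involute,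
    CliffordAlgebra.involute_involute]
  noncomm_ring

lemma lieForm_algebraMap (a : K) :
    lieForm l (algebraMap K (Forms K) a) =
      algebraMap K (Forms K) (l (KaehlerDifferential.D ℤ K a)) := by
  rw [lieForm_apply, contract_algebraMap, extD_algebraMap, map_zero, zero_add, dForm, contract_ι]

end LieDerivative

/-! ### Acyclicity of one step of the filtration -/

section Acyclicity

variable {R : Type u} [CommRing R] {K : Type u} [Field K] [Algebra R K]

lemma mem_twistedLogForms_span {E : Ideal R} {g : R} {q : ℕ} {w : Forms K} :
    w ∈ twistedLogForms K E (Ideal.span {g}) q ↔ ∃ v ∈ logForms K E q, g • v = w := by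
  rw [twistedLogForms, Submodule.ideal_span_singleton_smul]
  rfl

lemma mem_logForms_zero {E : Ideal R} {w : Forms K} :
    w ∈ logForms K E 0 ↔ ∃ r : R, algebraMap R (Forms K) r = w := by
  rw [logForms, pow_zero, Submodule.mem_one]

lemma mem_logForms_one {E : Ideal R} {w : Forms K} :
    w ∈ logForms K E 1 ↔ ∃ x ∈ logOneForms K E, ExteriorAlgebra.ι K x = w := by
  rw [logForms_one]
  rfl

lemma algebra_smul_forms (a : R) (w : Forms K) :
    a • w = algebraMap K (Forms K) (algebraMap R K a) * w := by
  rw [← Algebra.smul_def, algebraMap_smul]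

/-- Here η = dt/t. This is what makes dt vanish modulo t among logarithmic forms. -/
lemma exists_smul_eq_dForm {E : Ideal R} {t : R} (ht : t ∈ logUnits E) :
    ∃ η ∈ logForms K E 1, dForm (algebraMap R K t) = t • η := by
  refine ⟨_, inv_mul_dForm_mem ht, ?_⟩
  by_cases h0 : algebraMap R K t = 0
  · simp [h0, dForm_zero]
  · rw [algebra_smul_forms, ← mul_assoc, ← map_mul, mul_inv_cancel₀ h0, map_one, one_mul]

/-- The quotient of the complex of logarithmic forms twisted by `I` by the one twisted by `J` is
acyclic. -/
def IsRelAcyclic (K : Type u) [Field K] [Algebra R K] (E I J : Ideal R) : Prop :=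
  ∀ q, ∀ w ∈ twistedLogForms K E I q, extD w ∈ twistedLogForms K E J (q + 1) →
    ∃ v, (q = 0 → v = 0) ∧ (∀ r, q = r + 1 → v ∈ twistedLogForms K E I r) ∧
      w - extD v ∈ twistedLogForms K E J q

lemma IsRelAcyclic.refl (E I : Ideal R) : IsRelAcyclic K E I I :=
  fun _ w hw _ => ⟨0, fun _ => rfl, fun _ _ => zero_mem _, by simpa using hw⟩

/-- An extension of acyclic quotients is acyclic: subtract a first primitive to land in the J-twist,
then a second one to land in the L-twist. -/
lemma IsRelAcyclic.trans {E I J L : Ideal R} (hJI : J ≤ I) (hLJ : L ≤ J)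
    (h₁ : IsRelAcyclic K E I J) (h₂ : IsRelAcyclic K E J L) : IsRelAcyclic K E I L := by
  intro q w hw hdw
  obtain ⟨v, hv0, hv, hwv⟩ := h₁ q w hw (twistedLogForms_mono E hLJ _ hdw)
  obtain ⟨v', hv0', hv', hwv'⟩ := h₂ q _ hwv (by rwa [map_sub, extD_extD, sub_zero])
  refine ⟨v + v', fun h => by rw [hv0 h, hv0' h, add_zero],
    fun r h => add_mem (hv r h) (twistedLogForms_mono E hJI _ (hv' r h)), ?_⟩
  rwa [map_add, ← sub_sub]

variable {E : Ideal R} {l : Ω[K⁄ℤ] →ₗ[K] K} {δ : Derivation ℤ R R} {t : R}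

/-- A linear functional on one-forms that extends the logarithmic derivation `t δ`. -/
structure IsLogFunctional (E : Ideal R) (l : Ω[K⁄ℤ] →ₗ[K] K) (δ : Derivation ℤ R R) (t : R) :
    Prop where
  mem : t ∈ logUnits E
  apply_D : ∀ a : R, l (KaehlerDifferential.D ℤ K (algebraMap R K a)) = algebraMap R K (t * δ a)
  dlog : ∀ u ∈ logUnits E, ∃ (r : R) (n : ℕ), t * δ u = u * (t * r + n)

namespace IsLogFunctional

lemma apply_dlog (h : IsLogFunctional E l δ t) {u : R} (hu : u ∈ logUnits E) :
    ∃ (r : R) (n : ℕ), l ((algebraMap R K u)⁻¹ • KaehlerDifferential.D ℤ K (algebraMap R K u)) =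
      algebraMap R K (t * r + n) := by
  obtain ⟨r, n, e⟩ := h.dlog u hu
  by_cases h0 : algebraMap R K u = 0
  -- If u dies in K, its inverse there is 0 by convention and the form du/u is 0.
  · exact ⟨0, 0, by simp [h0]⟩
  · exact ⟨r, n, by rw [map_smul, h.apply_D, e, map_mul, smul_eq_mul, inv_mul_cancel_left₀ h0]⟩

lemma exists_apply_eq (h : IsLogFunctional E l δ t) {x : Ω[K⁄ℤ]} (hx : x ∈ logOneForms K E) :
    ∃ r : R, l x = algebraMap R K r := by
  induction hx using Submodule.span_induction with
  | mem x hx =>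
    obtain ⟨a, rfl⟩ | ⟨u, hu, rfl⟩ := hx
    · exact ⟨_, h.apply_D a⟩
    · obtain ⟨r, n, e⟩ := h.apply_dlog hu
      exact ⟨_, e⟩
  | zero => exact ⟨0, by simp⟩
  | add x y _ _ hx hy =>
    obtain ⟨r, hr⟩ := hx
    obtain ⟨s, hs⟩ := hy
    exact ⟨r + s, by rw [map_add, hr, hs, map_add]⟩
  | smul a x _ hx =>
    obtain ⟨r, hr⟩ := hx
    exact ⟨a * r, by rw [← algebraMap_smul K a x, map_smul, hr, smul_eq_mul, map_mul]⟩

lemma contract_mem (h : IsLogFunctional E l δ t) (q : ℕ) :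
    ∀ w ∈ logForms K E (q + 1), contract l w ∈ logForms K E q := by
  induction q with
  | zero =>
    intro w hw
    obtain ⟨x, hx, rfl⟩ := mem_logForms_one.1 hw
    obtain ⟨r, hr⟩ := h.exists_apply_eq hx
    rw [contract_ι, hr, mem_logForms_zero]
    exact ⟨r, IsScalarTower.algebraMap_apply R K (Forms K) r⟩
  | succ q ih =>
    intro w hw
    rw [logForms_succ] at hw
    induction hw using Submodule.mul_induction_on' with
    | mem_mul_mem v hv w hw =>
      obtain ⟨x, hx, rfl⟩ := mem_logForms_one.1 hv
      obtain ⟨r, hr⟩ := h.exists_apply_eq hx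
      rw [contract_ι_mul, hr, algebraMap_smul]
      refine sub_mem (Submodule.smul_mem _ _ hw) ?_
      rw [logForms_succ]
      exact Submodule.mul_mem_mul hv (ih w hw)
    | add x _ y _ hx hy => rw [map_add]; exact add_mem hx hy

lemma contract_zero (w : Forms K) (hw : w ∈ logForms K E 0) : contract l w = 0 := by
  obtain ⟨r, rfl⟩ := mem_logForms_zero.1 hw
  rw [IsScalarTower.algebraMap_apply R K (Forms K), contract_algebraMap]

/-- d(tr + n) = t(dr + r dt/t). The residue n disappears because it is an integer. -/
lemma dForm_mem_smul (h : IsLogFunctional E l δ t) (r : R) (n : ℕ) :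
    dForm (algebraMap R K (t * r + n)) ∈ twistedLogForms K E (Ideal.span {t}) 1 := by
  obtain ⟨η, hη, e⟩ := exists_smul_eq_dForm (K := K) h.mem
  have hn : dForm (algebraMap R K (n : R)) = 0 := by simp [dForm]
  rw [mem_twistedLogForms_span]
  refine ⟨dForm (algebraMap R K r) + r • η,
    add_mem (dForm_mem E r) (Submodule.smul_mem _ _ hη), ?_⟩
  rw [map_add, dForm_add, hn, add_zero, map_mul, dForm_mul, ← algebra_smul_forms,
    ← algebra_smul_forms, e, smul_add, smul_comm r t]

lemma lieForm_smul (h : IsLogFunctional E l δ t) (a : R) (w : Forms K) :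
    lieForm l (a • w) = (t * δ a) • w + a • lieForm l w := by
  rw [algebra_smul_forms a w, lieForm_mul, lieForm_algebraMap, h.apply_D, ← algebra_smul_forms,
    ← algebra_smul_forms]

/-- The generators da and du/u are closed, so L acts on them as d after contraction, and their
contractions have the form tr + n. The Leibniz rule does the rest, since tδ maps R into tR. -/
lemma lieForm_mem (h : IsLogFunctional E l δ t) (q : ℕ) :
    ∀ w ∈ logForms K E q, lieForm l w ∈ twistedLogForms K E (Ideal.span {t}) q := by
  have h1 : ∀ w ∈ logForms K E 1, lieForm l w ∈ twistedLogForms K E (Ideal.span {t}) 1 := by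
    intro w hw
    obtain ⟨x, hx, rfl⟩ := mem_logForms_one.1 hw
    induction hx using Submodule.span_induction with
    | mem x hx =>
      obtain ⟨a, rfl⟩ | ⟨u, hu, rfl⟩ := hx
      · have := h.dForm_mem_smul (δ a) 0
        rw [Nat.cast_zero, add_zero] at this
        rw [lieForm_apply, contract_ι, h.apply_D, extD_algebraMap]
        have e := extD_dForm (algebraMap R K a)
        rw [dForm] at e
        rwa [e, map_zero, add_zero]
      · obtain ⟨r, n, e⟩ := h.apply_dlog hu
        rw [lieForm_apply, contract_ι, e, extD_algebraMap]
        have e' := extD_dlog (algebraMap R K u)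
        rw [dForm, ← Algebra.smul_def, ← map_smul] at e'
        rw [e', map_zero, add_zero]
        exact h.dForm_mem_smul r n
    | zero => simp
    | add x y hx' hy' hx hy =>
      rw [map_add, map_add]
      exact add_mem (hx (mem_logForms_one.2 ⟨x, hx', rfl⟩)) (hy (mem_logForms_one.2 ⟨y, hy', rfl⟩))
    | smul a x hx ih =>
      have e : ExteriorAlgebra.ι K (a • x) = a • ExteriorAlgebra.ι K x :=
        ((ExteriorAlgebra.ι K).restrictScalars R).map_smul a x
      have hx' := mem_logForms_one.2 ⟨x, hx, rfl⟩
      rw [e, h.lieForm_smul]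
      refine add_mem ?_ (Submodule.smul_mem _ _ (ih hx'))
      exact mem_twistedLogForms_span.2 ⟨_, Submodule.smul_mem _ (δ a) hx', smul_smul _ _ _⟩
  induction q with
  | zero =>
    intro w hw
    obtain ⟨r, rfl⟩ := mem_logForms_zero.1 hw
    rw [IsScalarTower.algebraMap_apply R K (Forms K), lieForm_algebraMap, h.apply_D,
      mem_twistedLogForms_span]
    refine ⟨algebraMap R (Forms K) (δ r), mem_logForms_zero.2 ⟨_, rfl⟩, ?_⟩
    rw [← IsScalarTower.algebraMap_apply R K (Forms K), map_mul, Algebra.smul_def]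
  | succ q ih =>
    intro w hw
    rw [logForms_succ] at hw
    induction hw using Submodule.mul_induction_on' with
    | mem_mul_mem v hv w hw =>
      obtain ⟨v', hv', e⟩ := mem_twistedLogForms_span.1 (h1 v hv)
      obtain ⟨w', hw', e'⟩ := mem_twistedLogForms_span.1 (ih w hw)
      rw [lieForm_mul, ← e, ← e', mem_twistedLogForms_span]
      refine ⟨v' * w + v * w', ?_, by rw [smul_add, smul_mul_assoc, mul_smul_comm]⟩
      rw [logForms_succ]
      exact add_mem (Submodule.mul_mem_mul hv' hw) (Submodule.mul_mem_mul hv hw')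
    | add x _ y _ hx hy => rw [map_add]; exact add_mem hx hy

/-- The Lie derivative along `t δ` is a null-homotopic automorphism of the quotient of the
complexes of forms twisted by `a` and by `a t`, if `t δ` multiplies `a` by a unit integer. -/
lemma isRelAcyclic (h : IsLogFunctional E l δ t) {a : R} {m : ℕ} (ha : t * δ a = m * a)
    (hm : IsUnit (m : R)) : IsRelAcyclic K E (Ideal.span {a}) (Ideal.span {a * t}) := by
  have key : ∀ q, ∀ w ∈ twistedLogForms K E (Ideal.span {a}) (q + 1),
      contract l w ∈ twistedLogForms K E (Ideal.span {a}) q := by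
    intro q w hw
    obtain ⟨v, hv, rfl⟩ := mem_twistedLogForms_span.1 hw
    refine mem_twistedLogForms_span.2 ⟨contract l v, h.contract_mem q v hv, ?_⟩
    rw [← algebraMap_smul K a, ← map_smul, algebraMap_smul]
  intro q w hw hdw
  obtain ⟨c, hc⟩ := hm.exists_right_inv
  -- The inverse c of the integer m is a constant: m dc = d(mc) = 0. Hence multiplication by c
  -- commutes with d.
  have hdc : dForm (algebraMap R K c) = 0 := by
    have e : dForm (algebraMap R K ((m : R) * c)) = 0 := by
      rw [hc]; simp [dForm]
    have hn : dForm (algebraMap R K (m : R)) = 0 := by simp [dForm]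
    rw [map_mul, dForm_mul, hn, mul_zero, add_zero, ← algebra_smul_forms] at e
    rw [← one_smul R (dForm _), ← hc, mul_comm, mul_smul, e, smul_zero]
  -- For w = av, L(w) - mw = aL(v), and L(v) is divisible by t.
  have hlie : lieForm l w - (m : R) • w ∈ twistedLogForms K E (Ideal.span {a * t}) q := by
    obtain ⟨v, hv, rfl⟩ := mem_twistedLogForms_span.1 hw
    obtain ⟨v', hv', e⟩ := mem_twistedLogForms_span.1 (h.lieForm_mem q v hv)
    rw [h.lieForm_smul, ha, mul_smul, add_sub_cancel_left, ← e, ← mul_smul]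
    exact mem_twistedLogForms_span.2 ⟨v', hv', rfl⟩
  have hcon : contract l (extD w) ∈ twistedLogForms K E (Ideal.span {a * t}) q := by
    obtain ⟨v, hv, e⟩ := mem_twistedLogForms_span.1 hdw
    rw [← e]
    refine mem_twistedLogForms_span.2 ⟨contract l v, h.contract_mem q v hv, ?_⟩
    rw [← algebraMap_smul K (a * t), ← map_smul, algebraMap_smul]
  -- The primitive is ι(w)/m, by the homotopy formula: w - d(cιw) = c(ι(dw) - (Lw - mw)).
  refine ⟨c • contract l w, ?_, ?_, ?_⟩
  · rintro rfl
    obtain ⟨v, hv, rfl⟩ := mem_twistedLogForms_span.1 hw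
    rw [contract_zero _ (Submodule.smul_mem _ a hv), smul_zero]
  · rintro r rfl
    exact Submodule.smul_mem _ _ (key r w hw)
  · have e : w - extD (c • contract l w) =
        c • (contract l (extD w) - (lieForm l w - (m : R) • w)) := by
      have e1 : c • (m : R) • w = w := by rw [← mul_smul, mul_comm, hc, one_smul]
      rw [extD_smul, hdc, zero_mul, zero_add, smul_sub, smul_sub, e1, lieForm_apply, smul_add]
      abel
    rw [e]
    exact Submodule.smul_mem _ _ (sub_mem hcon hlie)

end IsLogFunctional

end Acyclicity

end
end LogDeRham

/-! ### Monomials in prime elements and Euler operators -/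

lemma exists_eq_unit_mul_prod_pow_of_dvd {R ι : Type*} [CommRing R] [IsDomain R] {x : ι → R}
    {J : Finset ι} (hx : ∀ j ∈ J, Prime (x j)) {u : R} {N : ℕ} (hu : u ∣ (∏ j ∈ J, x j) ^ N) :
    ∃ (c : Rˣ) (e : ι → ℕ), u = c * ∏ j ∈ J, x j ^ e j := by
  classical
  obtain ⟨v, hv⟩ := hu
  -- The power is written with N copies of each prime. A divisor takes a subset of these factors up
  -- to a unit, and its exponents count the copies taken.
  have h1 : u * v = 1 * ∏ p ∈ J ×ˢ Finset.range N, x p.1 := by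
    rw [← hv, one_mul, Finset.prod_product, ← Finset.prod_pow]
    simp
  obtain ⟨t, s, b, c, hts, -, hbc, hb, -⟩ := mul_eq_mul_prime_prod
    (fun p hp => hx p.1 (Finset.mem_product.1 hp).1) h1
  refine ⟨Units.mkOfMulEqOne b c hbc.symm, fun j => (t.filter fun p => p.1 = j).card, ?_⟩
  rw [hb, Finset.prod_comp x Prod.fst]
  refine congrArg _ (Finset.prod_subset ?_ fun j _ hj => ?_)
  · intro j hj
    obtain ⟨p, hp, rfl⟩ := Finset.mem_image.1 hj
    exact (Finset.mem_product.1 (hts ▸ Finset.mem_union_left s hp)).1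
  · rw [Finset.filter_eq_empty_iff.2, Finset.card_empty, pow_zero]
    rintro p hp rfl
    exact hj (Finset.mem_image_of_mem _ hp)

lemma Derivation.map_prod_eq_zero {R ι : Type*} [CommRing R] (δ : Derivation ℤ R R)
    {s : Finset ι} {y : ι → R} (h : ∀ j ∈ s, δ (y j) = 0) : δ (∏ j ∈ s, y j) = 0 := by
  classical
  induction s using Finset.induction_on with
  | empty => simp
  | insert a s ha ih =>
    rw [Finset.prod_insert ha, δ.leibniz, ih fun j hj => h j (Finset.mem_insert_of_mem hj),
      h a (Finset.mem_insert_self _ _), smul_zero, smul_zero, add_zero]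

/-- The operator x_i δ is the Euler operator of the variable x_i; a monomial is an eigenvector whose
eigenvalue is its exponent in x_i. -/
lemma Derivation.mul_map_prod_pow {R ι : Type*} [CommRing R] [DecidableEq ι]
    (δ : Derivation ℤ R R) {J : Finset ι} {x : ι → R} {i : ι} (hi : i ∈ J) (h1 : δ (x i) = 1)
    (h0 : ∀ j ∈ J, j ≠ i → δ (x j) = 0) (m : ι → ℕ) :
    x i * δ (∏ j ∈ J, x j ^ m j) = m i * ∏ j ∈ J, x j ^ m j := by
  have h2 : δ (∏ j ∈ J.erase i, x j ^ m j) = 0 := δ.map_prod_eq_zero fun j hj => by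
    rw [δ.leibniz_pow, h0 j (Finset.mem_of_mem_erase hj) (Finset.ne_of_mem_erase hj)]
    simp
  have h3 : x i * δ (x i ^ m i) = m i * x i ^ m i := by
    rw [δ.leibniz_pow, h1]
    cases m i with
    | zero => simp
    | succ k => simp [pow_succ]; ring
  rw [← Finset.mul_prod_erase J _ hi, δ.leibniz, h2, smul_zero, zero_add, smul_eq_mul,
    mul_left_comm, h3]
  ring

/-! ### Relative acyclicity for monomial twists -/

namespace LogDeRham
noncomputable section

variable {R : Type u} [CommRing R] {K : Type u} [Field K] [Algebra R K]

/-- A localization is formally étale, so Ω_K is the base change of Ω_R and the functional defined by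
tδ extends. -/
lemma exists_functional [IsFractionRing R K] (δ : Derivation ℤ R R) (t : R) :
    ∃ l : Ω[K⁄ℤ] →ₗ[K] K, ∀ a : R,
      l (KaehlerDifferential.D ℤ K (algebraMap R K a)) = algebraMap R K (t * δ a) := by
  have : Algebra.FormallyEtale R K := .of_isLocalization (nonZeroDivisors R)
  have hb := KaehlerDifferential.isBaseChange_of_formallyEtale ℤ R K
  refine ⟨hb.lift ((Algebra.linearMap R K).comp (t • δ).liftKaehlerDifferential), fun a => ?_⟩
  have e := hb.lift_eq ((Algebra.linearMap R K).comp (t • δ).liftKaehlerDifferential)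
    (KaehlerDifferential.D ℤ R a)
  rw [KaehlerDifferential.map_D] at e
  rw [e]
  simp

variable {ι : Type*} [DecidableEq ι] {x : ι → R} {J : Finset ι}

lemma exists_isLogFunctional [IsDomain R] [IsFractionRing R K] (hx : ∀ j ∈ J, Prime (x j)) {i : ι}
    (hi : i ∈ J) {δ : Derivation ℤ R R} (h1 : δ (x i) = 1)
    (h0 : ∀ j ∈ J, j ≠ i → δ (x j) = 0) :
    ∃ l : Ω[K⁄ℤ] →ₗ[K] K, IsLogFunctional (Ideal.span {∏ j ∈ J, x j}) l δ (x i) := by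
  obtain ⟨l, hl⟩ := exists_functional (K := K) δ (x i)
  refine ⟨l, ?_, hl, fun u hu => ?_⟩
  · change Ideal.span _ ≤ _
    rw [Ideal.span_singleton_le_iff_mem]
    exact Ideal.le_radical (Ideal.mem_span_singleton.2 (Finset.dvd_prod_of_mem _ hi))
  · change Ideal.span _ ≤ _ at hu
    rw [Ideal.span_singleton_le_iff_mem] at hu
    obtain ⟨N, hN⟩ := hu
    obtain ⟨c, e, rfl⟩ := exists_eq_unit_mul_prod_pow_of_dvd hx (Ideal.mem_span_singleton.1 hN)
    -- The logarithmic derivative of u = c ∏ x_j^{e_j} along x_i δ is x_i δ(c)/c + e_i.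
    refine ⟨↑c⁻¹ * δ c, e i, ?_⟩
    have h3 := δ.mul_map_prod_pow hi h1 h0 e
    have hc : (c : R) * ↑c⁻¹ = 1 := c.mul_inv
    rw [δ.leibniz, smul_eq_mul, smul_eq_mul, mul_add, mul_left_comm, h3]
    linear_combination (-(∏ j ∈ J, x j ^ e j) * x i * δ c) * hc

/-- Relative acyclicity for two monomials in the members of a system of logarithmic coordinates,
if the exponents between those of the two monomials are invertible. -/
lemma isRelAcyclic_monomial [IsDomain R] [IsFractionRing R K] (hx : ∀ j ∈ J, Prime (x j))
    (hδ : ∀ i ∈ J, ∃ δ : Derivation ℤ R R, δ (x i) = 1 ∧ ∀ j ∈ J, j ≠ i → δ (x j) = 0)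
    (e m : ι → ℕ) (hme : ∀ j ∈ J, m j ≤ e j)
    (hu : ∀ j ∈ J, ∀ k, m j ≤ k → k < e j → IsUnit (k : R)) :
    IsRelAcyclic K (Ideal.span {∏ j ∈ J, x j}) (Ideal.span {∏ j ∈ J, x j ^ m j})
      (Ideal.span {∏ j ∈ J, x j ^ e j}) := by
  -- Induction on the number of coordinate factors still to be multiplied in.
  induction hN : ∑ j ∈ J, (e j - m j) generalizing m with
  | zero =>
    have : ∏ j ∈ J, x j ^ m j = ∏ j ∈ J, x j ^ e j := Finset.prod_congr rfl fun j hj => by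
      have := Finset.sum_eq_zero_iff.1 hN j hj
      rw [le_antisymm (hme j hj) (Nat.sub_eq_zero_iff_le.1 this)]
    rw [this]
    exact .refl _ _
  | succ N ih =>
    obtain ⟨i, hi, hi'⟩ : ∃ i ∈ J, e i - m i ≠ 0 := by
      by_contra! h
      rw [Finset.sum_eq_zero h] at hN
      omega
    have hlt : m i < e i := by omega
    set m' : ι → ℕ := Function.update m i (m i + 1) with hm'
    have hm'i : m' i = m i + 1 := Function.update_self ..
    have hm'j : ∀ j ∈ J.erase i, m' j = m j := fun j hj =>
      Function.update_of_ne (Finset.ne_of_mem_erase hj) _ _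
    have hprod : ∏ j ∈ J, x j ^ m' j = (∏ j ∈ J, x j ^ m j) * x i := by
      rw [← Finset.mul_prod_erase J _ hi, ← Finset.mul_prod_erase J (fun j => x j ^ m j) hi, hm'i,
        Finset.prod_congr rfl fun j hj => by rw [hm'j j hj]]
      ring
    have hm'le : ∀ j ∈ J, m j ≤ m' j ∧ m' j ≤ e j := fun j hj => by
      by_cases h : j = i
      · subst h; omega
      · rw [hm'j j (Finset.mem_erase.2 ⟨h, hj⟩)]; exact ⟨le_rfl, hme j hj⟩
    have hsum : ∑ j ∈ J, (e j - m' j) = N := by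
      rw [← Finset.add_sum_erase J _ hi] at hN ⊢
      rw [Finset.sum_congr rfl fun j hj => by rw [hm'j j hj], hm'i]
      omega
    have h2 := ih m' (fun j hj => (hm'le j hj).2)
      (fun j hj k hk => hu j hj k ((hm'le j hj).1.trans hk)) hsum
    obtain ⟨δ, h1, h0⟩ := hδ i hi
    obtain ⟨l, hl⟩ := exists_isLogFunctional (K := K) hx hi h1 h0
    -- Raising the exponent of x_i from m_i to m_i + 1 requires that the old exponent m_i be
    -- invertible.
    have h3 := hl.isRelAcyclic (δ.mul_map_prod_pow hi h1 h0 m) (hu i hi _ le_rfl hlt)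
    rw [← hprod] at h3
    refine h3.trans ?_ ?_ h2
    · rw [Ideal.span_singleton_le_span_singleton, hprod]
      exact dvd_mul_right _ _
    · rw [Ideal.span_singleton_le_span_singleton]
      exact Finset.prod_dvd_prod_of_dvd _ _ fun j hj => pow_dvd_pow _ (hm'le j hj).2

end
end LogDeRham

/-! ### Regular systems of parameters consist of primes -/

section RegularLocalRing

open IsLocalRing

variable {R : Type*} [CommRing R]

/-- Since y can replace one member of a minimal system of generators, the embedding dimension of the
quotient drops by at least one, while the Krull dimension drops by at most one. -/
lemma IsRegularLocalRing.quotient_span_singleton [IsRegularLocalRing R] {y : R}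
    (hy : y ∈ maximalIdeal R) (hy2 : y ∉ maximalIdeal R ^ 2) :
    ∃ _ : IsRegularLocalRing (R ⧸ Ideal.span {y}),
      (maximalIdeal (R ⧸ Ideal.span {y})).spanFinrank < (maximalIdeal R).spanFinrank := by
  classical
  have : Nontrivial (R ⧸ Ideal.span {y}) := Ideal.Quotient.nontrivial_iff.2 fun h =>
    (maximalIdeal.isMaximal R).ne_top (top_le_iff.1 (h ▸ (Ideal.span_singleton_le_iff_mem _).2 hy))
  have : IsLocalRing (R ⧸ Ideal.span {y}) := .of_surjective' _ Ideal.Quotient.mk_surjective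
  obtain ⟨s, hs, hspan⟩ := Submodule.FG.exists_span_finset_card_eq_spanFinrank
    (IsNoetherian.noetherian (maximalIdeal R))
  rw [← hspan] at hy
  obtain ⟨a, -, ha⟩ := Submodule.mem_span_finset.1 hy
  -- If all coefficients of y were nonunits, y would lie in the square of the maximal ideal.
  obtain ⟨x, hx, hax⟩ : ∃ x ∈ s, IsUnit (a x) := by
    by_contra! h
    refine hy2 (ha ▸ Submodule.sum_mem _ fun x hx => ?_)
    rw [pow_two]
    exact Ideal.mul_mem_mul ((mem_maximalIdeal _).2 (h x hx))
      (hspan ▸ Submodule.subset_span hx)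
  let π := Ideal.Quotient.mk (Ideal.span {y})
  have hmap : maximalIdeal (R ⧸ Ideal.span {y}) = Ideal.span (π '' (s.erase x : Finset R)) := by
    have h1 : maximalIdeal (R ⧸ Ideal.span {y}) = Ideal.span (π '' s) := by
      rw [← Ideal.map_span, show Ideal.span (s : Set R) = maximalIdeal R from hspan]
      exact (IsLocalRing.map_maximalIdeal_of_surjective π Ideal.Quotient.mk_surjective).symm
    rw [h1]
    refine le_antisymm (Ideal.span_le.2 ?_)
      (Ideal.span_mono (Set.image_mono (Finset.coe_subset.2 (Finset.erase_subset x s))))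
    rintro _ ⟨z, hz, rfl⟩
    by_cases hzx : z = x
    · subst hzx
      have h2 : π (a z) * π z = -∑ w ∈ s.erase z, π (a w) * π w := by
        have h3 : π y = 0 := Ideal.Quotient.eq_zero_iff_mem.2 (Ideal.mem_span_singleton_self y)
        have h3' := congrArg π ha
        rw [h3, map_sum, ← Finset.add_sum_erase s _ hx] at h3'
        simp only [smul_eq_mul, map_mul] at h3'
        exact eq_neg_of_add_eq_zero_left h3'
      have h4 : π (a z) * π z ∈ Ideal.span (π '' (s.erase z : Finset R)) := by
        rw [h2]
        exact neg_mem (Submodule.sum_mem _ fun w hw =>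
          Ideal.mul_mem_left _ _ (Ideal.subset_span ⟨w, hw, rfl⟩))
      exact (Ideal.unit_mul_mem_iff_mem _ (hax.map π)).1 h4
    · exact Ideal.subset_span ⟨z, Finset.mem_erase.2 ⟨hzx, hz⟩, rfl⟩
  have hcard : (maximalIdeal (R ⧸ Ideal.span {y})).spanFinrank + 1 ≤
      (maximalIdeal R).spanFinrank := by
    have h5 := Submodule.spanFinrank_span_le_ncard_of_finite (R := R ⧸ Ideal.span {y})
      (Set.toFinite (π '' (s.erase x : Finset R)))
    have h6 := Set.ncard_image_le (f := π) (Set.toFinite (s.erase x : Set R))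
    rw [Set.ncard_coe_finset, Finset.card_erase_of_mem hx] at h6
    have h7 : 0 < s.card := Finset.card_pos.2 ⟨x, hx⟩
    rw [show Submodule.span (R ⧸ Ideal.span {y}) (π '' (s.erase x : Finset R)) =
      maximalIdeal (R ⧸ Ideal.span {y}) from hmap.symm] at h5
    omega
  refine ⟨IsRegularLocalRing.of_spanFinrank_maximalIdeal_le _ ?_, hcard⟩
  have h8 : ringKrullDim R ≤ ringKrullDim (R ⧸ Ideal.span {y}) + 1 := by
    have := ringKrullDim_le_ringKrullDim_quotient_add_encard {y} (by
      rw [Set.singleton_subset_iff, ringJacobson_eq_maximalIdeal, ← hspan]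
      exact hy)
    simpa using this
  rw [← IsRegularLocalRing.spanFinrank_maximalIdeal (R := R)] at h8
  have h9 : (((maximalIdeal (R ⧸ Ideal.span {y})).spanFinrank : ℕ) : WithBot ℕ∞) + 1 ≤
      ringKrullDim (R ⧸ Ideal.span {y}) + 1 := le_trans (by exact_mod_cast hcard) h8
  generalize ringKrullDim (R ⧸ Ideal.span {y}) = d at h9 ⊢
  induction d using WithBot.recBotCoe with
  | bot => simp at h9
  | coe d =>
    have h10 : (((maximalIdeal (R ⧸ Ideal.span {y})).spanFinrank : ℕ) : ℕ∞) + 1 ≤ d + 1 := by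
      exact_mod_cast h9
    exact_mod_cast (ENat.add_le_add_iff_right ENat.one_ne_top).1 h10

/-- Induction on the embedding dimension. Choose y in the maximal ideal, outside its square and all
minimal primes. Then R/(y) is a domain by induction, so (y) contains a minimal prime q. As y is not
in q, q = yq, and q = 0 by Nakayama. -/
lemma IsRegularLocalRing.isDomain [IsRegularLocalRing R] : IsDomain R := by
  obtain ⟨n, hn⟩ : ∃ n, (maximalIdeal R).spanFinrank = n := ⟨_, rfl⟩
  induction n using Nat.strong_induction_on generalizing R with
  | _ n ih =>
  by_cases h0 : maximalIdeal R = ⊥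
  · exact ((isField_iff_maximalIdeal_eq).2 h0).isDomain
  have hdim := IsRegularLocalRing.spanFinrank_maximalIdeal (R := R)
  have hfg : (maximalIdeal R).FG := IsNoetherian.noetherian _
  obtain ⟨y, hy, hy'⟩ : ∃ y ∈ maximalIdeal R,
      y ∉ ⋃ I ∈ insert (maximalIdeal R ^ 2) (minimalPrimes R), (I : Set R) := by
    by_contra! h
    -- Prime avoidance tolerates the one nonprime ideal, the square of the maximal ideal.
    obtain ⟨I, hI, hle⟩ := (Ideal.subset_union_prime_finite (f := id)
      (((minimalPrimes.finite_of_isNoetherianRing R)).insert (maximalIdeal R ^ 2))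
      (maximalIdeal R ^ 2) (maximalIdeal R ^ 2) (fun I hI h1 _ =>
        ((Set.mem_insert_iff.1 hI).resolve_left h1).1.1)).1 h
    obtain rfl | hI := Set.mem_insert_iff.1 hI
    · refine h0 (Submodule.eq_bot_of_le_smul_of_le_jacobson_bot _ _ hfg (hle.trans ?_)
        (IsLocalRing.maximalIdeal_le_jacobson _))
      rw [id, pow_two]; exact le_rfl
    -- Otherwise the maximal ideal is a minimal prime, the dimension is 0, and by regularity the
    -- maximal ideal vanishes.
    · have hIp : I.IsPrime := hI.1.1
      obtain rfl : maximalIdeal R = I := (maximalIdeal.isMaximal R).eq_of_le hIp.ne_top hle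
      have h1 := Ideal.height_eq_zero_iff.2 hI
      have h2 := IsLocalRing.maximalIdeal_height_eq_ringKrullDim (R := R)
      rw [h1, ← hdim] at h2
      have h3 : (maximalIdeal R).spanFinrank = 0 := by exact_mod_cast h2.symm
      exact h0 ((Submodule.spanFinrank_eq_zero_iff_eq_bot hfg).1 h3)
  simp only [Set.mem_iUnion, not_exists] at hy'
  obtain ⟨hreg, hlt⟩ := IsRegularLocalRing.quotient_span_singleton hy
    (hy' _ (Set.mem_insert _ _))
  have hdom : IsDomain (R ⧸ Ideal.span {y}) := ih _ (hn ▸ hlt) rfl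
  have hprime : (Ideal.span {y}).IsPrime := (Ideal.Quotient.isDomain_iff_prime _).1 hdom
  obtain ⟨q, hq, hqy⟩ := Ideal.exists_minimalPrimes_le (bot_le (a := Ideal.span {y}))
  have hqp : q.IsPrime := hq.1.1
  have hyq : y ∉ q := hy' q (Set.mem_insert_of_mem _ hq)
  have hq0 : q = ⊥ := by
    refine Submodule.eq_bot_of_le_smul_of_le_jacobson_bot (maximalIdeal R) _
      (IsNoetherian.noetherian _) (fun a ha => ?_) (IsLocalRing.maximalIdeal_le_jacobson _)
    obtain ⟨b, rfl⟩ := Ideal.mem_span_singleton'.1 (hqy ha)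
    rw [mul_comm]
    exact Submodule.smul_mem_smul hy ((hqp.mem_or_mem ha).resolve_right hyq)
  rw [hq0] at hqp
  exact IsDomain.of_bot_isPrime R

variable {n : ℕ} {x : Fin n → R}

lemma linearIndependent_toCotangent_of_span_eq [IsRegularLocalRing R]
    (hn : (n : WithBot ℕ∞) = ringKrullDim R) (hx : Ideal.span (Set.range x) = maximalIdeal R) :
    LinearIndependent (ResidueField R) (fun j => (maximalIdeal R).toCotangent
      ⟨x j, hx ▸ Ideal.subset_span ⟨j, rfl⟩⟩ : Fin n → CotangentSpace R) := by
  refine linearIndependent_of_top_le_span_of_card_eq_finrank ?_ ?_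
  · rintro z -
    obtain ⟨⟨z, hz⟩, rfl⟩ := Ideal.toCotangent_surjective _ z
    have hz' := hz
    rw [← hx] at hz'
    obtain ⟨c, rfl⟩ := (Submodule.mem_span_range_iff_exists_fun R).1 hz'
    have e : (⟨∑ j, c j • x j, hz⟩ : maximalIdeal R) =
        ∑ j, c j • ⟨x j, hx ▸ Ideal.subset_span ⟨j, rfl⟩⟩ := by
      apply Subtype.ext
      simp
    rw [e, map_sum]
    refine Submodule.sum_mem _ fun j _ => ?_
    rw [map_smul, ← IsScalarTower.algebraMap_smul (ResidueField R) (c j)]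
    exact Submodule.smul_mem _ _ (Submodule.subset_span ⟨j, rfl⟩)
  · have h := IsRegularLocalRing.spanFinrank_maximalIdeal (R := R)
    rw [spanFinrank_maximalIdeal_eq_finrank_cotangentSpace, ← hn] at h
    rw [Fintype.card_fin]
    exact_mod_cast h.symm

/-- A parameter is nonzero in the cotangent space, so the quotient by it is regular and hence a
domain. -/
lemma prime_of_span_eq_maximalIdeal [IsRegularLocalRing R]
    (hn : (n : WithBot ℕ∞) = ringKrullDim R) (hx : Ideal.span (Set.range x) = maximalIdeal R)
    (j : Fin n) : Prime (x j) := by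
  have hmem : x j ∈ maximalIdeal R := hx ▸ Ideal.subset_span ⟨j, rfl⟩
  have h2 : x j ∉ maximalIdeal R ^ 2 := fun h =>
    (linearIndependent_toCotangent_of_span_eq hn hx).ne_zero j
      ((Ideal.toCotangent_eq_zero _ _).2 h)
  obtain ⟨hreg, -⟩ := IsRegularLocalRing.quotient_span_singleton hmem h2
  have hdom : IsDomain (R ⧸ Ideal.span {x j}) := IsRegularLocalRing.isDomain
  refine (Ideal.span_singleton_prime ?_).1 ((Ideal.Quotient.isDomain_iff_prime _).1 hdom)
  intro h
  exact h2 (h ▸ zero_mem _)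

end RegularLocalRing

/-! ### Formal smoothness of extensions of a perfect field -/

section FormallySmoothField

open MvPolynomial

/-- In the presentation of L with one variable for each element, H1 is the kernel of I/I² → ⊕ L
dX_i. Written in polynomials, its vanishing can be tested with finitely many elements of L at a
time. -/
lemma Algebra.subsingleton_h1Cotangent_iff_pderiv (K L : Type*) [CommRing K] [CommRing L]
    [Algebra K L] :
    Subsingleton (Algebra.H1Cotangent K L) ↔
      ∀ p : MvPolynomial L K, aeval _root_.id p = (0 : L) → (∀ i, aeval _root_.id (pderiv i p) = (0 : L)) →
        p ∈ RingHom.ker (aeval (R := K) (_root_.id : L → L)) ^ 2 := by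
  let P := Generators.self K L
  have hker : P.toExtension.ker = RingHom.ker (aeval (R := K) (_root_.id : L → L)) :=
    P.ker_eq_ker_aeval_val
  have hval : P.val = _root_.id := rfl
  rw [Extension.subsingleton_h1Cotangent, injective_iff_map_eq_zero]
  constructor
  · intro h p hp hd
    have hp' : p ∈ P.toExtension.ker := by rw [hker]; exact hp
    have := h (.mk ⟨p, hp'⟩) (by
      rw [Extension.cotangentComplex_mk]
      apply P.cotangentSpaceBasis.repr.injective
      ext i
      rw [Generators.cotangentSpaceBasis_repr_one_tmul, map_zero, hval]
      exact hd i)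
    rw [Extension.Cotangent.mk_eq_zero_iff] at this
    change p ∈ P.toExtension.ker ^ 2 at this
    rwa [hker] at this
  · intro h x hx
    obtain ⟨⟨p, hp⟩, rfl⟩ := Extension.Cotangent.mk_surjective x
    rw [Extension.Cotangent.mk_eq_zero_iff]
    change p ∈ P.toExtension.ker ^ 2
    rw [hker]
    rw [Extension.cotangentComplex_mk] at hx
    refine h p (by rw [hker] at hp; exact hp) fun i => ?_
    rw [← hval, ← P.cotangentSpaceBasis_repr_one_tmul, hx, map_zero]
    rfl

/-- Every extension of a perfect field is formally smooth. -/
lemma PerfectField.formallySmooth (K L : Type*) [Field K] [PerfectField K] [Field L]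
    [Algebra K L] : Algebra.FormallySmooth K L := by
  classical
  refine ⟨inferInstance, ?_⟩
  rw [Algebra.subsingleton_h1Cotangent_iff_pderiv]
  intro p hp hd
  -- The polynomial p already lives over the finitely generated extension M, for which the vanishing
  -- of H1 is known.
  let M : IntermediateField K L := IntermediateField.adjoin K (p.vars : Set L)
  have : Algebra.EssFiniteType K M :=
    IntermediateField.essFiniteType_iff.2 (IntermediateField.fg_adjoin_finset _)
  obtain ⟨q, hqp⟩ := exists_rename_eq_of_vars_subset_range p (Subtype.val : M → L)
    Subtype.val_injective fun l hl =>
      ⟨⟨l, IntermediateField.subset_adjoin K _ hl⟩, rfl⟩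
  have key : ∀ r : MvPolynomial M K,
      aeval _root_.id (rename Subtype.val r) = algebraMap M L (aeval _root_.id r) := fun r => by
    rw [aeval_rename, ← aeval_algebraMap_apply]
    rfl
  rw [← hqp] at hp hd ⊢
  have hq := (Algebra.subsingleton_h1Cotangent_iff_pderiv K M).1 inferInstance q
    ((algebraMap M L).injective (by rw [← key, hp, map_zero]))
    fun i => (algebraMap M L).injective (by
      rw [← key, ← pderiv_rename Subtype.val_injective, hd, map_zero])
  have hmap := Ideal.mem_map_of_mem (rename (R := K) (Subtype.val : M → L)) hq
  rw [Ideal.map_pow] at hmap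
  refine Ideal.pow_right_mono (Ideal.map_le_iff_le_comap.2 fun r hr => ?_) 2 hmap
  change aeval _root_.id (rename Subtype.val r) = (0 : L)
  rw [key, show aeval _root_.id r = (0 : M) from hr, map_zero]

end FormallySmoothField

/-! ### Derivations dual to a regular system of parameters -/

section DualDerivations

open IsLocalRing TensorProduct

/-- Derivations dual to a regular system of parameters of a regular local ring that is formally
smooth over a perfect field. -/
lemma exists_derivation_of_span_eq_maximalIdeal (k : Type*) [Field k] [PerfectField k]
    {R : Type*} [CommRing R] [Algebra k R] [Algebra.FormallySmooth k R] [IsRegularLocalRing R]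
    {n : ℕ} {x : Fin n → R}
    (hn : (n : WithBot ℕ∞) = ringKrullDim R) (hx : Ideal.span (Set.range x) = maximalIdeal R)
    (i : Fin n) : ∃ δ : Derivation k R R, δ (x i) = 1 ∧ ∀ j, j ≠ i → δ (x j) = 0 := by
  have hκ : Algebra.FormallySmooth k (ResidueField R) := PerfectField.formallySmooth _ _
  -- A retraction of the conormal map from m/m² to κ ⊗ Ω_R, which exists because the residue field κ
  -- is formally smooth.
  obtain ⟨l, hl⟩ := (Algebra.FormallySmooth.iff_split_injection
    (R := k) (P := R) (A := ResidueField R) residue_surjective).1 hκ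
  have hli := linearIndependent_toCotangent_of_span_eq hn hx
  have hker : RingHom.ker (algebraMap R (ResidueField R)) = maximalIdeal R := ker_residue
  have hmem : ∀ j, x j ∈ RingHom.ker (algebraMap R (ResidueField R)) := fun j => by
    rw [hker, ← hx]; exact Ideal.subset_span ⟨j, rfl⟩
  have hdual : ∀ i, ∃ φ : CotangentSpace R →ₗ[ResidueField R] ResidueField R, ∀ j,
      φ ((maximalIdeal R).toCotangent ⟨x j, hker ▸ hmem j⟩) = if i = j then 1 else 0 := by
    intro i
    obtain ⟨φ, hφ⟩ := ((Finsupp.lapply i).comp hli.repr).exists_extend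
    refine ⟨φ, fun j => ?_⟩
    have h1 := LinearMap.congr_fun hφ ⟨_, Submodule.subset_span ⟨j, rfl⟩⟩
    have h2 := hli.repr_eq_single j ⟨_, Submodule.subset_span ⟨j, rfl⟩⟩ rfl
    rw [LinearMap.comp_apply, LinearMap.comp_apply, h2, Finsupp.lapply_apply,
      Finsupp.single_apply] at h1
    simp only [eq_comm (a := i)]
    exact h1
  have hlift : ∀ i, ∃ Λ : Ω[R⁄k] →ₗ[R] R, ∀ j,
      residue R (Λ (KaehlerDifferential.D k R (x j))) = if i = j then 1 else 0 := by
    intro i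
    obtain ⟨φ, hφ⟩ := hdual i
    let ψ : Ω[R⁄k] →ₗ[R] ResidueField R := (φ.restrictScalars R) ∘ₗ
      (Ideal.mapCotangent _ (maximalIdeal R) (AlgHom.id R R) hker.le) ∘ₗ l ∘ₗ
      (TensorProduct.mk R (ResidueField R) (Ω[R⁄k]) 1)
    -- Formal smoothness of R makes Ω_R projective, so the functional with values in κ lifts to R.
    obtain ⟨Λ, hΛ⟩ := Module.projective_lifting_property (Algebra.linearMap R (ResidueField R)) ψ
      residue_surjective
    refine ⟨Λ, fun j => ?_⟩
    have h1 := LinearMap.congr_fun hl (Ideal.toCotangent _ ⟨x j, hmem j⟩)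
    have h2 := LinearMap.congr_fun hΛ (KaehlerDifferential.D k R (x j))
    refine h2.trans ?_
    rw [← hφ j]
    change φ (Ideal.mapCotangent _ _ _ _ (l (1 ⊗ₜ _))) = _
    rw [LinearMap.comp_apply, KaehlerDifferential.kerCotangentToTensor_toCotangent] at h1
    rw [h1]
    rfl
  choose Λ hΛ using hlift
  -- The lifted functionals are dual to the dx_j only modulo the maximal ideal. Their matrix is
  -- therefore invertible, and its inverse corrects them to exact duality.
  let M : Matrix (Fin n) (Fin n) R := .of fun i j => Λ i (KaehlerDifferential.D k R (x j))
  have hM : M.map (residue R) = 1 := by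
    ext i j
    rw [Matrix.map_apply, Matrix.one_apply]
    exact hΛ i j
  have hdet : IsUnit M.det := by
    apply isUnit_of_map_unit (residue R)
    rw [RingHom.map_det]
    change IsUnit (M.map (residue R)).det
    rw [hM, Matrix.det_one]
    exact isUnit_one
  have hinv := Matrix.nonsing_inv_mul M hdet
  let δ : Derivation k R R := (∑ a, M⁻¹ i a • Λ a).compDer (KaehlerDifferential.D k R)
  have hδ : ∀ j, δ (x j) = (1 : Matrix (Fin n) (Fin n) R) i j := fun j => by
    rw [← hinv, Matrix.mul_apply]
    change (∑ a, M⁻¹ i a • Λ a) _ = _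
    simp [M]
  exact ⟨δ, by rw [hδ, Matrix.one_apply_eq], fun j hj => by
    rw [hδ, Matrix.one_apply_ne hj.symm]⟩

end DualDerivations

/-! ### Stalks of logarithmic forms spread to neighbourhoods -/

namespace LogDeRham
noncomputable section

section Spreading

open Filter Topology

variable {Y : Scheme.{u}} [IsIntegral Y]

lemma algebraMap_germ_eq {U : Y.Opens} {y z : Y} (hy : y ∈ U) (hz : z ∈ U) (s : Γ(Y, U)) :
    algebraMap (Y.presheaf.stalk z) Y.functionField (Y.presheaf.germ U z hz s) =
      algebraMap (Y.presheaf.stalk y) Y.functionField (Y.presheaf.germ U y hy s) := by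
  have : Nonempty U := ⟨⟨y, hy⟩⟩
  rw [Scheme.algebraMap_germ_eq_germToFunctionField,
    Scheme.algebraMap_germ_eq_germToFunctionField]

lemma eventually_exists_algebraMap_eq {y : Y} (a : Y.presheaf.stalk y) :
    ∀ᶠ z in 𝓝 y, ∃ b : Y.presheaf.stalk z,
      algebraMap _ Y.functionField b = algebraMap _ Y.functionField a := by
  obtain ⟨U, hy, s, rfl⟩ := Y.presheaf.exists_germ_eq a
  filter_upwards [U.2.mem_nhds hy] with z hz
  exact ⟨Y.presheaf.germ U z hz s, algebraMap_germ_eq hy hz s⟩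

/-- By noetherianity, finitely many relations e^N = uc, one for each generator e of E, witness the
condition on u, and each of them holds at nearby points. -/
lemma eventually_exists_logUnits [IsLocallyNoetherian Y] (E : Y.IdealSheafData) {y : Y}
    {u : Y.presheaf.stalk y} (hu : u ∈ logUnits (stalkIdeal E y)) :
    ∀ᶠ z in 𝓝 y, ∃ v ∈ logUnits (stalkIdeal E z),
      algebraMap _ Y.functionField v = algebraMap _ Y.functionField u := by
  obtain ⟨U, hy⟩ := exists_affine y
  have : IsNoetherianRing Γ(Y, U.1) := IsLocallyNoetherian.component_noetherian U
  obtain ⟨T, hT⟩ := (isNoetherianRing_iff_ideal_fg _).1 this (E.ideal U)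
  have key : ∀ e ∈ T, ∀ᶠ z in 𝓝 y, ∃ (N : ℕ) (c : Y.presheaf.stalk z),
      (algebraMap _ Y.functionField (Y.presheaf.germ U.1 y hy e)) ^ N =
        algebraMap _ Y.functionField u * algebraMap _ Y.functionField c := by
    intro e he
    have h1 : Y.presheaf.germ U.1 y hy e ∈ stalkIdeal E y := by
      rw [stalkIdeal_eq E y U hy]
      exact Ideal.mem_map_of_mem _ (hT ▸ Ideal.subset_span he)
    obtain ⟨N, hN⟩ := hu h1
    obtain ⟨c, hc⟩ := Ideal.mem_span_singleton.1 hN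
    filter_upwards [eventually_exists_algebraMap_eq c] with z ⟨c', hc'⟩
    exact ⟨N, c', by rw [hc', ← map_pow, ← map_mul, hc]⟩
  filter_upwards [U.1.2.mem_nhds hy, eventually_exists_algebraMap_eq u,
    (Filter.eventually_all_finset T).2 key] with z hz ⟨v, hv⟩ hzT
  refine ⟨v, ?_, hv⟩
  change stalkIdeal E z ≤ _
  rw [stalkIdeal_eq E z U hz, ← hT, Ideal.map_span, Ideal.span_le]
  rintro _ ⟨e, he, rfl⟩
  obtain ⟨N, c, hc⟩ := hzT e he
  refine ⟨N, Ideal.mem_span_singleton.2 ⟨c, ?_⟩⟩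
  apply IsFractionRing.injective (Y.presheaf.stalk z) Y.functionField
  rw [map_pow, map_mul, hv, ← hc]
  exact congrArg (· ^ N) (algebraMap_germ_eq hy hz e)

lemma eventually_smul_mem {y : Y} {N : ∀ z : Y, Submodule (Y.presheaf.stalk z)
      (Forms Y.functionField)} (a : Y.presheaf.stalk y) {w : Forms Y.functionField}
    (hw : ∀ᶠ z in 𝓝 y, w ∈ N z) : ∀ᶠ z in 𝓝 y, a • w ∈ N z := by
  filter_upwards [hw, eventually_exists_algebraMap_eq a] with z hz ⟨b, hb⟩
  have : a • w = b • w := by rw [algebra_smul_forms, algebra_smul_forms, hb]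
  rw [this]
  exact Submodule.smul_mem _ _ hz

lemma eventually_mem_logForms [IsLocallyNoetherian Y] (E : Y.IdealSheafData) (q : ℕ) (y : Y) :
    ∀ w ∈ logForms Y.functionField (stalkIdeal E y) q,
      ∀ᶠ z in 𝓝 y, w ∈ logForms Y.functionField (stalkIdeal E z) q := by
  have h1 : ∀ w ∈ logForms Y.functionField (stalkIdeal E y) 1,
      ∀ᶠ z in 𝓝 y, w ∈ logForms Y.functionField (stalkIdeal E z) 1 := by
    intro w hw
    obtain ⟨x, hx, rfl⟩ := mem_logForms_one.1 hw
    induction hx using Submodule.span_induction with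
    | mem x hx =>
      obtain ⟨a, rfl⟩ | ⟨u, hu, rfl⟩ := hx
      · filter_upwards [eventually_exists_algebraMap_eq a] with z ⟨b, hb⟩
        rw [← hb]
        exact dForm_mem _ b
      · filter_upwards [eventually_exists_logUnits E hu] with z ⟨v, hv, e⟩
        rw [← e]
        exact mem_logForms_one.2 ⟨_, Submodule.subset_span (Or.inr ⟨v, hv, rfl⟩), rfl⟩
    | zero => simp
    | add x x' hx hx' ih ih' =>
      filter_upwards [ih (mem_logForms_one.2 ⟨x, hx, rfl⟩),
        ih' (mem_logForms_one.2 ⟨x', hx', rfl⟩)] with z hz hz'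
      rw [map_add]
      exact add_mem hz hz'
    | smul a x hx ih =>
      have e : ExteriorAlgebra.ι Y.functionField (a • x) =
          a • ExteriorAlgebra.ι Y.functionField x :=
        ((ExteriorAlgebra.ι Y.functionField).restrictScalars (Y.presheaf.stalk y)).map_smul a x
      rw [e]
      exact eventually_smul_mem a (ih (mem_logForms_one.2 ⟨x, hx, rfl⟩))
  induction q with
  | zero =>
    intro w hw
    obtain ⟨a, rfl⟩ := mem_logForms_zero.1 hw
    rw [Algebra.algebraMap_eq_smul_one]
    exact eventually_smul_mem a (.of_forall fun z => mem_logForms_zero.2 ⟨1, map_one _⟩)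
  | succ q ih =>
    intro w hw
    rw [logForms_succ] at hw
    induction hw using Submodule.mul_induction_on' with
    | mem_mul_mem v hv w hw =>
      filter_upwards [h1 v hv, ih w hw] with z hz hz'
      rw [logForms_succ]
      exact Submodule.mul_mem_mul hz hz'
    | add x _ x' _ hx hx' =>
      filter_upwards [hx, hx'] with z hz hz'
      exact add_mem hz hz'

lemma isSpreading_logStalk [IsLocallyNoetherian Y] (E D : Y.IdealSheafData) (q : ℕ) :
    IsSpreading (X := Y.toPresheafedSpace.carrier) (logStalk E D q) := by
  intro y w hw
  suffices h : ∀ᶠ z in 𝓝 y, w ∈ logStalk E D q z by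
    obtain ⟨U, hU, hUo, hy⟩ := eventually_nhds_iff.1 h
    exact ⟨⟨U, hUo⟩, hy, fun z hz => hU z hz⟩
  change w ∈ stalkIdeal D y • logForms Y.functionField (stalkIdeal E y) q at hw
  induction hw using Submodule.smul_induction_on' with
  | smul r hr n hn =>
    obtain ⟨U, hy⟩ := exists_affine y
    rw [stalkIdeal_eq D y U hy] at hr
    induction hr using Submodule.span_induction generalizing n with
    | mem r hr =>
      obtain ⟨s, hs, rfl⟩ := hr
      filter_upwards [eventually_mem_logForms E q y n hn, U.1.2.mem_nhds hy] with z hz hzU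
      have e : (Y.presheaf.germ U.1 y hy).hom s • n = (Y.presheaf.germ U.1 z hzU).hom s • n := by
        rw [algebra_smul_forms, algebra_smul_forms]
        exact congrArg (fun a => algebraMap Y.functionField (Forms Y.functionField) a * n)
          (algebraMap_germ_eq hzU hy s)
      rw [e]
      refine Submodule.smul_mem_smul ?_ hz
      rw [stalkIdeal_eq D z U hzU]
      exact Ideal.mem_map_of_mem _ hs
    | zero => simp [zero_mem]
    | add r r' _ _ ih ih' =>
      filter_upwards [ih n hn, ih' n hn] with z hz hz'
      rw [add_smul]
      exact add_mem hz hz'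
    | smul a r _ ih =>
      -- The stalk coefficient is absorbed into the form, which is why n is generalized; only
      -- sections of the ideal over U have to be spread.
      rw [smul_assoc, smul_comm]
      exact ih _ (Submodule.smul_mem _ a hn)
  | add x _ x' _ hx hx' =>
    filter_upwards [hx, hx'] with z hz hz'
    exact add_mem hz hz'

end Spreading

end
end LogDeRham

/-! ### Generizations, components and multiplicities -/

lemma Module.le_length_quotient_of_le_span_pow {R : Type*} [CommRing R] [IsDomain R] {t : R}
    (ht0 : t ≠ 0) (ht : ¬ IsUnit t) {e : ℕ} {I : Ideal R} (hI : I ≤ Ideal.span {t ^ e}) :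
    (e : ℕ∞) ≤ Module.length R (R ⧸ I) := by
  have key : ∀ n : ℕ, (n : ℕ∞) ≤ Module.length R (R ⧸ Ideal.span {t ^ n}) := by
    intro n
    induction n with
    | zero => simp
    | succ n ih =>
      have hle : Ideal.span {t ^ (n + 1)} ≤ Ideal.span {t ^ n} := by
        rw [Ideal.span_singleton_le_span_singleton]
        exact pow_dvd_pow _ n.le_succ
      let π : (R ⧸ Ideal.span {t ^ (n + 1)}) →ₗ[R] R ⧸ Ideal.span {t ^ n} :=
        Submodule.factor hle
      have hπ : Function.Surjective π := Submodule.factor_surjective hle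
      have h1 := Module.length_eq_add_of_exact (LinearMap.ker π).subtype π
        (Submodule.subtype_injective _) hπ (LinearMap.exact_subtype_ker_map π)
      -- The class of t^n survives modulo t^(n+1) since t is not a unit, so each step adds at least
      -- one to the length.
      have h2 : Nontrivial (LinearMap.ker π) := by
        refine ⟨⟨Submodule.Quotient.mk (t ^ n), ?_⟩, 0, fun h => ?_⟩
        · rw [LinearMap.mem_ker]
          exact (Submodule.Quotient.mk_eq_zero _).2 (Ideal.mem_span_singleton_self _)
        · have h3 := (Submodule.Quotient.mk_eq_zero _).1 (congrArg Subtype.val h)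
          obtain ⟨c, hc⟩ := Ideal.mem_span_singleton.1 h3
          refine ht (IsUnit.of_mul_eq_one c (mul_left_cancel₀ (pow_ne_zero n ht0) ?_))
          rw [mul_one, ← mul_assoc, ← pow_succ, ← hc]
      have h4 : (1 : ℕ∞) ≤ Module.length R (LinearMap.ker π) :=
        Order.one_le_iff_pos.2 Module.length_pos
      rw [h1, Nat.cast_succ, add_comm]
      exact add_le_add h4 ih
  exact (key e).trans (Module.length_le_of_surjective (Submodule.factor hI)
    (Submodule.factor_surjective hI))

namespace LogDeRham
noncomputable section

section Generizations

variable {Y : Scheme.{u}} {y z : Y}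

/-- The prime ideal of the local ring at `y` that corresponds to a generization of `y`. -/
def primeOfGenerization (h : z ⤳ y) : Ideal (Y.presheaf.stalk y) :=
  (IsLocalRing.maximalIdeal (Y.presheaf.stalk z)).comap (Y.presheaf.stalkSpecializes h).hom

lemma stalkIdeal_map_stalkSpecializes (D : Y.IdealSheafData) (h : z ⤳ y) :
    (stalkIdeal D y).map (Y.presheaf.stalkSpecializes h).hom = stalkIdeal D z := by
  obtain ⟨U, hU⟩ := exists_affine y
  have hz : z ∈ U.1 := h.mem_open U.1.2 hU
  rw [stalkIdeal_eq D y U hU, stalkIdeal_eq D z U hz, Ideal.map_map, ← CommRingCat.hom_comp]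
  exact congrArg (fun g => (D.ideal U).map (CommRingCat.Hom.hom g))
    (Y.presheaf.germ_stalkSpecializes hU h)

lemma mem_support_iff_stalkIdeal_le (D : Y.IdealSheafData) (z : Y) :
    z ∈ D.support ↔ stalkIdeal D z ≤ IsLocalRing.maximalIdeal (Y.presheaf.stalk z) := by
  constructor
  · intro hz
    obtain ⟨U, hU⟩ := exists_affine z
    rw [stalkIdeal_eq D z U hU, Ideal.map_le_iff_le_comap]
    intro s hs
    rw [D.mem_support_iff_of_mem hU, Scheme.mem_zeroLocus_iff] at hz
    have := hz s hs
    rw [Y.mem_basicOpen s z hU] at this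
    exact this
  · intro h
    by_contra hz
    rw [stalkIdeal_eq_top hz] at h
    exact (IsLocalRing.maximalIdeal.isMaximal _).ne_top (top_le_iff.1 h)

lemma mem_support_iff_le_primeOfGenerization (D : Y.IdealSheafData) (h : z ⤳ y) :
    z ∈ D.support ↔ stalkIdeal D y ≤ primeOfGenerization h := by
  rw [mem_support_iff_stalkIdeal_le, ← stalkIdeal_map_stalkSpecializes D h,
    Ideal.map_le_iff_le_comap, primeOfGenerization]

lemma comap_germ_primeOfGenerization (h : z ⤳ y) {U : Y.Opens} (hU : IsAffineOpen U) (hy : y ∈ U)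
    (hz : z ∈ U) : (primeOfGenerization h).comap (Y.presheaf.germ U y hy).hom =
      (hU.primeIdealOf ⟨z, hz⟩).asIdeal := by
  rw [hU.primeIdealOf_eq_map_closedPoint, primeOfGenerization, Ideal.comap_comap,
    ← CommRingCat.hom_comp, Y.presheaf.germ_stalkSpecializes hy h]
  rfl

instance isPrime_primeOfGenerization (h : z ⤳ y) : (primeOfGenerization h).IsPrime :=
  Ideal.comap_isPrime _ _

lemma eq_of_primeOfGenerization_eq {z' : Y} (h : z ⤳ y) (h' : z' ⤳ y)
    (e : primeOfGenerization h = primeOfGenerization h') : z = z' := by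
  obtain ⟨U, hU⟩ := exists_affine y
  have hz : z ∈ U.1 := h.mem_open U.1.2 hU
  have hz' : z' ∈ U.1 := h'.mem_open U.1.2 hU
  have h1 := comap_germ_primeOfGenerization h U.2 hU hz
  rw [e, comap_germ_primeOfGenerization h' U.2 hU hz'] at h1
  have h2 := congrArg U.2.fromSpec (PrimeSpectrum.ext h1)
  rw [U.2.fromSpec_primeIdealOf, U.2.fromSpec_primeIdealOf] at h2
  exact h2.symm

lemma exists_primeOfGenerization_eq (p : Ideal (Y.presheaf.stalk y)) [hp : p.IsPrime] :
    ∃ (z : Y) (h : z ⤳ y), primeOfGenerization h = p := by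
  obtain ⟨U, hU⟩ := exists_affine y
  let := TopCat.Presheaf.algebra_section_stalk Y.presheaf ⟨y, hU⟩
  have hloc := U.2.isLocalization_stalk ⟨y, hU⟩
  have hqp : (p.comap (Y.presheaf.germ U.1 y hU).hom).IsPrime := Ideal.comap_isPrime _ _
  let Q : PrimeSpectrum Γ(Y, U.1) := ⟨p.comap (Y.presheaf.germ U.1 y hU).hom, hqp⟩
  have hle : Q ≤ U.2.primeIdealOf ⟨y, hU⟩ := by
    rw [U.2.primeIdealOf_eq_map_closedPoint]
    change Q.asIdeal ≤ (IsLocalRing.maximalIdeal _).comap (Y.presheaf.germ U.1 y hU).hom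
    exact Ideal.comap_mono (IsLocalRing.le_maximalIdeal hp.ne_top)
  have hopen := U.2.isOpenImmersion_fromSpec
  have hspec : U.2.fromSpec Q ⤳ y := by
    have := ((PrimeSpectrum.le_iff_specializes _ _).1 hle).map U.2.fromSpec.continuous
    rwa [U.2.fromSpec_primeIdealOf] at this
  have hz : U.2.fromSpec Q ∈ U.1 := hspec.mem_open U.1.2 hU
  have hQ : U.2.primeIdealOf ⟨U.2.fromSpec Q, hz⟩ = Q :=
    U.2.fromSpec.isOpenEmbedding.injective (U.2.fromSpec_primeIdealOf _)
  refine ⟨_, hspec, ?_⟩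
  have h1 := comap_germ_primeOfGenerization hspec U.2 hU hz
  rw [hQ] at h1
  -- A prime of the local ring is determined by its contraction to the affine chart.
  rw [← IsLocalization.map_under (U.2.primeIdealOf ⟨y, hU⟩).asIdeal.primeCompl
    (Y.presheaf.stalk y) (primeOfGenerization hspec),
    ← IsLocalization.map_under (U.2.primeIdealOf ⟨y, hU⟩).asIdeal.primeCompl
    (Y.presheaf.stalk y) p]
  exact congrArg (Ideal.map _) h1

lemma primeOfGenerization_le {z' : Y} (h : z ⤳ y) (h' : z' ⤳ z) :
    primeOfGenerization (h'.trans h) ≤ primeOfGenerization h := by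
  intro a ha
  rw [primeOfGenerization, Ideal.mem_comap] at ha ⊢
  rw [← Y.presheaf.stalkSpecializes_comp h' h] at ha
  by_contra hu
  rw [IsLocalRing.mem_maximalIdeal, mem_nonunits_iff, not_not] at hu
  exact (IsLocalRing.mem_maximalIdeal _).1 ha (hu.map (Y.presheaf.stalkSpecializes h').hom)

lemma stalkSpecializes_injective [IsIntegral Y] (h : z ⤳ y) :
    Function.Injective (Y.presheaf.stalkSpecializes h).hom := by
  have h1 := IsFractionRing.injective (Y.presheaf.stalk y) Y.functionField
  have h2 : ((algebraMap (Y.presheaf.stalk z) Y.functionField).comp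
      (Y.presheaf.stalkSpecializes h).hom) = algebraMap _ _ := by
    simp only [RingHom.algebraMap_toAlgebra]
    rw [← CommRingCat.hom_comp, Y.presheaf.stalkSpecializes_comp]
  rw [← h2] at h1
  exact Function.Injective.of_comp h1

/-- A prime divisor `t` at `y`, minimal over a divisor `D`, comes from a component of `D`, whose
multiplicity is at least that of `t` in the ideal of `D` at `y`. -/
lemma exists_component_le_multiplicity [IsIntegral Y] {D : Y.IdealSheafData}
    {t : Y.presheaf.stalk y} (ht : Prime t) {e : ℕ} (he : e ≠ 0)
    (hle : stalkIdeal D y ≤ Ideal.span {t ^ e})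
    (hmin : ∀ q : Ideal (Y.presheaf.stalk y), q.IsPrime → stalkIdeal D y ≤ q →
      q ≤ Ideal.span {t} → q = Ideal.span {t}) :
    ∃ Z ∈ components D, ∃ η : Y, IsGenericPoint η Z ∧ (e : ℕ∞) ≤ multiplicity D η := by
  have hp : (Ideal.span {t}).IsPrime := (Ideal.span_singleton_prime ht.ne_zero).2 ht
  obtain ⟨η, hη, e1⟩ := exists_primeOfGenerization_eq (Ideal.span {t})
  have hD : stalkIdeal D y ≤ Ideal.span {t} := hle.trans
    (Ideal.span_singleton_le_span_singleton.2 (dvd_pow_self t he))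
  have hηD : η ∈ D.support := (mem_support_iff_le_primeOfGenerization D hη).2 (e1 ▸ hD)
  refine ⟨closure {η}, ⟨⟨isIrreducible_singleton.closure,
    D.support.isClosed.closure_subset_iff.2 (Set.singleton_subset_iff.2 hηD)⟩, ?_⟩, η, rfl, ?_⟩
  · rintro Z' ⟨hZ', hZ'D⟩ hZ
    -- The generic point ζ of a larger irreducible subset of D corresponds to a prime inside (t)
    -- containing the ideal of D; by minimality it is (t), so ζ = η.
    obtain ⟨ζ, hζ⟩ := QuasiSober.sober hZ'.closure isClosed_closure
    have hζη : ζ ⤳ η := hζ.specializes (subset_closure (hZ (subset_closure rfl)))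
    have hζD : ζ ∈ D.support :=
      (D.support.isClosed.closure_subset_iff.2 hZ'D) hζ.mem
    have e2 : primeOfGenerization (hζη.trans hη) = Ideal.span {t} :=
      hmin _ inferInstance ((mem_support_iff_le_primeOfGenerization D _).1 hζD)
        (e1 ▸ primeOfGenerization_le hη hζη)
    have e3 : ζ = η := eq_of_primeOfGenerization_eq _ _ (e2.trans e1.symm)
    subst e3
    change Z' ⊆ closure {ζ}
    rw [hζ.def]
    exact subset_closure
  · refine Module.le_length_quotient_of_le_span_pow
      (t := (Y.presheaf.stalkSpecializes hη).hom t) ?_ ?_ ?_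
    · rw [Ne, map_eq_zero_iff _ (stalkSpecializes_injective hη)]
      exact ht.ne_zero
    · have : t ∈ primeOfGenerization hη := e1 ▸ Ideal.mem_span_singleton_self t
      exact this
    · rw [← stalkIdeal_map_stalkSpecializes D hη, Ideal.map_le_iff_le_comap]
      refine hle.trans ?_
      rw [Ideal.span_singleton_le_iff_mem, Ideal.mem_comap, map_pow]
      exact Ideal.mem_span_singleton_self _

end Generizations

end
end LogDeRham

/-! ### Local structure of a divisor with normal crossings -/

/-- Derivations dual to a regular system of parameters of a local ring that is formally smooth
over an arbitrary field. -/
lemma exists_int_derivation_of_span_eq_maximalIdeal {k R : Type u} [Field k] [CommRing R]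
    [IsRegularLocalRing R] {g : k →+* R} (hg : g.FormallySmooth) {n : ℕ} {x : Fin n → R}
    (hn : (n : WithBot ℕ∞) = ringKrullDim R)
    (hx : Ideal.span (Set.range x) = IsLocalRing.maximalIdeal R) (i : Fin n) :
    ∃ δ : Derivation ℤ R R, δ (x i) = 1 ∧ ∀ j, j ≠ i → δ (x j) = 0 := by
  -- The field k may be imperfect, so the base is lowered to the prime field: k is formally smooth
  -- over it, hence so is R.
  have key : ∀ (F : Type) [Field F] [PerfectField F] [Algebra F k],
      ∃ δ : Derivation ℤ R R, δ (x i) = 1 ∧ ∀ j, j ≠ i → δ (x j) = 0 := by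
    intro F _ _ _
    let _ : Algebra k R := g.toAlgebra
    let _ : Algebra F R := (g.comp (algebraMap F k)).toAlgebra
    have : IsScalarTower F k R := .of_algebraMap_eq' rfl
    have h1 : Algebra.FormallySmooth k R := hg
    have h2 : Algebra.FormallySmooth F k := PerfectField.formallySmooth F k
    have h3 : Algebra.FormallySmooth F R := .comp F k R
    obtain ⟨δ, hδ⟩ := exists_derivation_of_span_eq_maximalIdeal F hn hx i
    exact ⟨δ.restrictScalars ℤ, hδ⟩
  obtain ⟨p, hp⟩ := CharP.exists k
  obtain hp' | rfl := CharP.char_is_prime_or_zero k p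
  · have := Fact.mk hp'
    let _ : Algebra (ZMod p) k := ZMod.algebra k p
    exact key (ZMod p)
  · have : CharZero k := CharP.charP_to_charZero k
    exact key ℚ

/-- If `h` divides a product of distinct coordinates and `g` is a multiple of `h` with the same
radical, then both are monomials in the coordinates, up to units, with the same support. -/
lemma exists_span_singleton_eq_span_prod_pow {R ι : Type*} [CommRing R] [IsDomain R] {x : ι → R}
    {J : Finset ι} (hx : ∀ j ∈ J, Prime (x j)) {g h : R} {N : ℕ} (h1 : h ∣ ∏ j ∈ J, x j)
    (h2 : h ∣ g) (h3 : g ∣ h ^ N) :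
    ∃ m e : ι → ℕ, Ideal.span {h} = Ideal.span {∏ j ∈ J, x j ^ m j} ∧
      Ideal.span {g} = Ideal.span {∏ j ∈ J, x j ^ e j} ∧
      ∀ j ∈ J, m j ≤ e j ∧ (m j = 0 → e j = 0) := by
  classical
  obtain ⟨c, m, hm⟩ := exists_eq_unit_mul_prod_pow_of_dvd (u := h) hx (N := 1)
    (by rwa [pow_one])
  -- Only coordinates dividing h occur in h^N, so the cofactor g/h involves no others. This gives
  -- equality of supports.
  let J' := J.filter fun j => m j ≠ 0
  have hJ' : ∏ j ∈ J, x j ^ m j = ∏ j ∈ J', x j ^ m j := by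
    rw [Finset.prod_filter]
    refine Finset.prod_congr rfl fun j _ => ?_
    split_ifs with h0
    · rfl
    · rw [not_not.1 h0, pow_zero]
  have hdvd : ∏ j ∈ J', x j ^ m j ∣ (∏ j ∈ J', x j) ^ (∑ j ∈ J', m j) := by
    rw [← Finset.prod_pow]
    exact Finset.prod_dvd_prod_of_dvd _ _ fun j hj =>
      pow_dvd_pow _ (Finset.single_le_sum (fun _ _ => Nat.zero_le _) hj)
  obtain ⟨g', rfl⟩ := h2
  have h4 : g' ∣ (∏ j ∈ J', x j) ^ ((∑ j ∈ J', m j) * N) := by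
    refine (Dvd.intro_left h rfl).trans (h3.trans ?_)
    rw [pow_mul]
    refine pow_dvd_pow_of_dvd ?_ N
    rw [hm, hJ', Units.mul_left_dvd]
    exact hdvd
  obtain ⟨c', e', he'⟩ := exists_eq_unit_mul_prod_pow_of_dvd
    (fun j hj => hx j (Finset.mem_filter.1 hj).1) h4
  refine ⟨m, fun j => m j + if m j ≠ 0 then e' j else 0, ?_, ?_, fun j _ => ⟨Nat.le_add_right _ _, ?_⟩⟩
  · rw [hm, Ideal.span_singleton_mul_left_unit c.isUnit]
  · have h5 : ∏ j ∈ J, x j ^ (m j + if m j ≠ 0 then e' j else 0) =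
        (∏ j ∈ J, x j ^ m j) * ∏ j ∈ J', x j ^ e' j := by
      rw [Finset.prod_filter, ← Finset.prod_mul_distrib]
      refine Finset.prod_congr rfl fun j _ => ?_
      split_ifs with h0
      · rw [pow_add]
      · rw [add_zero, mul_one]
    rw [h5, hm, he', mul_mul_mul_comm,
      Ideal.span_singleton_mul_left_unit (c.isUnit.mul c'.isUnit)]
  · intro h0
    simp [h0]

/-! ### Acyclicity at a point of the modulus pair, and conclusion -/

namespace LogDeRham
noncomputable section

variable {k : Type u} [Field k] {Y : Scheme.{u}}

lemma exists_formallySmooth_stalk (f : Y ⟶ Spec (CommRingCat.of k)) [Smooth f] (y : Y) :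
    ∃ g : k →+* Y.presheaf.stalk y, g.FormallySmooth := by
  obtain ⟨U, hU⟩ := exists_affine y
  have h1 : (f.appLE ⊤ U.1 le_top).hom.FormallySmooth :=
    (f.smooth_appLE (isAffineOpen_top _) U.2 le_top).formallySmooth
  have h2 : (Scheme.ΓSpecIso (CommRingCat.of k)).inv.hom.FormallySmooth :=
    .of_bijective (ConcreteCategory.bijective_of_isIso (Scheme.ΓSpecIso (CommRingCat.of k)).inv)
  have h3 : (Y.presheaf.germ U.1 y hU).hom.FormallySmooth := by
    let _ := TopCat.Presheaf.algebra_section_stalk Y.presheaf ⟨y, hU⟩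
    have hloc := U.2.isLocalization_stalk ⟨y, hU⟩
    exact Algebra.FormallySmooth.of_isLocalization
      (Rₘ := Y.presheaf.stalk y) (U.2.primeIdealOf ⟨y, hU⟩).asIdeal.primeCompl
  exact ⟨_, (h2.comp h1).comp h3⟩

variable [IsIntegral Y]

/-- At every point, the quotient of the relative de Rham complex of `D_red` by that of `D` is
acyclic. -/
lemma IsModulusPair.isRelAcyclic (f : Y ⟶ Spec (CommRingCat.of k)) [Smooth f]
    {F D : Y.IdealSheafData} (h : IsModulusPair F D)
    (he : ∀ p : ℕ, p.Prime → CharP k p → ∀ Z ∈ components D, ∀ η : Y, IsGenericPoint η Z →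
      multiplicity D η < p) (y : Y) :
    IsRelAcyclic Y.functionField (stalkIdeal (D.radical * F) y) (stalkIdeal D.radical y)
      (stalkIdeal D y) := by
  classical
  obtain ⟨g', hg'⟩ := exists_formallySmooth_stalk f y
  by_cases hy : y ∈ (D.radical * F).support
  swap
  · have h1 : stalkIdeal D y = ⊤ := by
      rw [← Ideal.radical_eq_top, ← top_le_iff, ← stalkIdeal_eq_top hy]
      exact IsModulusPair.le_radical y
    have h2 : stalkIdeal D.radical y = ⊤ :=
      top_le_iff.1 (h1.ge.trans (stalkIdeal_mono D.le_radical y))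
    rw [h1, h2]
    exact .refl _ _
  obtain ⟨hreg, n, x, J, hn, hx, hE⟩ := h.snc_sum y hy
  have hprime : ∀ j, Prime (x j) := prime_of_span_eq_maximalIdeal hn hx
  obtain ⟨⟨r, hr⟩, -⟩ := h.isLogTwist_radical y
  obtain ⟨⟨g, hg⟩, -⟩ := h.isLogTwist y
  change stalkIdeal D.radical y = Ideal.span {r} at hr
  change stalkIdeal D y = Ideal.span {g} at hg
  have hrE : r ∣ ∏ j ∈ J, x j := by
    rw [← Ideal.span_singleton_le_span_singleton, ← hE, stalkIdeal_mul, hr]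
    exact Ideal.mul_le_left
  have hrg : r ∣ g := by
    rw [← Ideal.span_singleton_le_span_singleton, ← hr, ← hg]
    exact stalkIdeal_mono D.le_radical y
  obtain ⟨N, hN⟩ : r ∈ (stalkIdeal D y).radical :=
    stalkIdeal_radical_le D y (hr ▸ Ideal.mem_span_singleton_self r)
  rw [hg, Ideal.mem_span_singleton] at hN
  obtain ⟨m, e, hm, hge, hme⟩ :=
    exists_span_singleton_eq_span_prod_pow (fun j _ => hprime j) hrE hrg hN
  have hD : stalkIdeal D y = Ideal.span {∏ j ∈ J, x j ^ e j} := hg.trans hge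
  rw [hE, hD, hr, hm]
  refine isRelAcyclic_monomial (fun j _ => hprime j) (fun i _ => ?_) e m
    (fun j hj => (hme j hj).1) fun j hj a hma hae => ?_
  · obtain ⟨δ, h1, h0⟩ := exists_int_derivation_of_span_eq_maximalIdeal hg' hn hx i
    exact ⟨δ, h1, fun j _ => h0 j⟩
  -- The exponent 0 never has to be inverted, because D and D_red have the same support.
  · have ha0 : a ≠ 0 := by
      rintro rfl
      have := (hme j hj).2 (Nat.le_zero.1 hma)
      omega
    obtain ⟨Z, hZ, η, hη, hmult⟩ := exists_component_le_multiplicity (D := D) (hprime j)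
      (e := e j) (by omega)
      (by
        rw [hD, Ideal.span_singleton_le_span_singleton]
        exact Finset.dvd_prod_of_mem (fun j => x j ^ e j) hj)
      -- A prime inside (x_j) that contains the monomial of D contains some x_i. Then x_j divides
      -- x_i, so the two primes are associated and q = (x_j).
      (fun q hq hDq hqj => by
        rw [hD, Ideal.span_singleton_le_iff_mem] at hDq
        obtain ⟨i, -, hi⟩ := (hq.prod_mem_iff).1 hDq
        have hi' := hq.mem_of_pow_mem _ hi
        have hdvd : x j ∣ x i := Ideal.mem_span_singleton.1 (hqj hi')
        have hassoc := (hprime j).associated_of_dvd (hprime i) hdvd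
        refine le_antisymm hqj ?_
        rw [Ideal.span_singleton_eq_span_singleton.2 hassoc, Ideal.span_singleton_le_iff_mem]
        exact hi')
    -- In characteristic p, 0 < a < e_j ≤ multiplicity < p, so a is invertible in k and then in the
    -- local ring.
    have hak : (a : k) ≠ 0 := by
      obtain ⟨p, hp⟩ := CharP.exists k
      intro h0
      rw [CharP.cast_eq_zero_iff k p] at h0
      obtain hp' | rfl := CharP.char_is_prime_or_zero k p
      · have h1 : (e j : ℕ∞) < p := hmult.trans_lt (he p hp' hp Z hZ η hη)
        have h2 : e j < p := by exact_mod_cast h1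
        have := Nat.le_of_dvd (Nat.pos_of_ne_zero ha0) h0
        omega
      · exact ha0 (Nat.eq_zero_of_zero_dvd h0)
    have := (IsUnit.mk0 (a : k) hak).map g'
    rwa [map_natCast] at this

end
end LogDeRham

/-- Independence of the relative de Rham complex from the multiplicities of `D`. -/
theorem lemma5p1 {k : Type u} [Field k] {Y : AlgebraicGeometry.Scheme.{u}}
    (f : Y ⟶ AlgebraicGeometry.Spec (CommRingCat.of k))
    [AlgebraicGeometry.IsIntegral Y] [AlgebraicGeometry.Smooth f]
    [AlgebraicGeometry.IsSeparated f] [AlgebraicGeometry.QuasiCompact f]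
    (F D : Y.IdealSheafData) (h : LogDeRham.IsModulusPair F D)
    (he : ∀ p : ℕ, p.Prime → CharP k p →
      ∀ Z ∈ LogDeRham.components D, ∀ η : Y, IsGenericPoint η Z →
        LogDeRham.multiplicity D η < p) :
    QuasiIso (LogDeRham.relDeRhamInclusion h.isLogTwist h.isLogTwist_radical D.le_radical) := by
  -- Finite type over a field supplies the noetherian hypothesis needed for spreading.
  have : IsLocallyNoetherian Y := LocallyOfFiniteType.isLocallyNoetherian f
  exact LogDeRham.quasiIso_relDeRhamInclusion _ _ _ (LogDeRham.isSpreading_logStalk _ _)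
    (LogDeRham.isSpreading_logStalk _ _) fun y => h.isRelAcyclic f he y
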